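/- Conventions. A category is regular if it has finite limits, every kernel pair has a coequalizer, and regular epimorphisms are stable under pullback; it is (Barr-)exact if it is regular and every equivalence relation in it is the kernel pair of some morphism. A category $\mathcal C$ with pullbacks is protomodular if for every pullback $g\colon D\to E$ of a morphism $f\colon A\to B$ along a split epimorphism $p\colon E\to B$ with section $s\colon B\to E$, the pair $(g,s)$ is jointly strongly epimorphic. A category has stable coequalizers of equivalence relations if every equivalence relation $R\rightrightarrows X$ has a coequalizer $X\to Q$ and, for every morphism $Y\to Q$, the pullback of $R\rightrightarrows X\to Q$ along $Y\to Q$ is again a coequalizer diagram. A category $\mathcal X$ is a semi-localization of $\mathcal C$ if there is a fully faithful functor $U\colon\mathcal X\to\mathcal C$ with a left adjoint $L$ (and unit $\eta$) which is semi-left-exact, i.e. $L$ preserves every pullback of a morphism $Uf\colon UA\to ULQ$ along $\eta_Q\colon Q\to ULQ$. For a regular category $\mathcal X$, its exact completion $\mathcal X_{\mathrm{ex/reg}}$ as a regular category is the category of maps (total and single-valued morphisms) in the bicategory obtained from the bicategory of relations in $\mathcal X$ by splitting the equivalence relations; the canonical functor $I\colon\mathcal X\to\mathcal X_{\mathrm{ex/reg}}$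 sends an object to the identity relation on it and a morphism to its graph. Theorem. For a category $\mathcal X$, the following conditions are equivalent: (a) $\mathcal X$ is regular, protomodular, and has stable coequalizers of equivalence relations; (b) $\mathcal X$ is a semi-localization of an exact protomodular category $\mathcal C$; (c) $\mathcal X$ is a semi-localization of an exact protomodular category $\mathcal C$, and the components of the unit of the reflection are regular epimorphisms; (d) $\mathcal X$ is regular, $\mathcal X$ is a semi-localization of its exact completion $\mathcal X_{\mathrm{ex/reg}}$ as a regular category (via the canonical functor $I$), and $\mathcal X_{\mathrm{ex/reg}}$ is protomodular. -/

import Mathlib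

open CategoryTheory CategoryTheory.Limits

universe w₁ w₂ v u

namespace SemiLoc

section Basic

variable {C : Type u} [Category.{v} C]

/-- A pair of morphisms with common codomain is jointly strongly epimorphic if it is jointly
epimorphic and jointly left orthogonal to every monomorphism. -/
structure JointlyStrongEpi {A B E : C} (g : A ⟶ E) (s : B ⟶ E) : Prop where
  hom_ext : ∀ ⦃T : C⦄ (a b : E ⟶ T), g ≫ a = g ≫ b → s ≫ a = s ≫ b → a = b
  exists_lift : ∀ ⦃M N : C⦄ (m : M ⟶ N) [Mono m] (a : A ⟶ M) (b : B ⟶ M) (t : E ⟶ N),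
    a ≫ m = g ≫ t → b ≫ m = s ≫ t →
      ∃ l : E ⟶ M, g ≫ l = a ∧ s ≫ l = b ∧ l ≫ m = t

variable (C) in
/-- A category with pullbacks is protomodular if, for every pullback `g : D ⟶ E` of a morphism
`f : A ⟶ B` along a split epimorphism `p : E ⟶ B` with section `s`, the pair `(g, s)` is jointly
strongly epimorphic. -/
structure IsProtomodular : Prop where
  hasPullbacks : HasPullbacks C
  jointlyStrongEpi : ∀ ⦃D E A B : C⦄ (g : D ⟶ E) (q : D ⟶ A) (p : E ⟶ B) (f : A ⟶ B) (s : B ⟶ E),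
    IsPullback g q p f → s ≫ p = 𝟙 B → JointlyStrongEpi g s

variable (C) in
/-- A (Barr-)exact category: a regular category in which every equivalence relation is the kernel
pair of some morphism. -/
structure IsBarrExact : Prop where
  regular : Regular C
  effective : ∀ ⦃R X : C⦄ (d c : R ⟶ X), IsEquivalenceRelation d c →
    ∃ (Q : C) (q : X ⟶ Q), IsKernelPair q d c

variable (C) in
/-- Every equivalence relation `d, c : R ⟶ X` has a coequalizer `q : X ⟶ Q`, and for every
`f : Y ⟶ Q` the pullback of the diagram `R ⇉ X ⟶ Q` along `f` is again a coequalizer diagram. -/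
def HasStableCoequalizersOfEquivalenceRelations : Prop :=
  ∀ ⦃R X : C⦄ (d c : R ⟶ X), IsEquivalenceRelation d c →
    ∃ (Q : C) (q : X ⟶ Q) (w : d ≫ q = c ≫ q),
      Nonempty (IsColimit (Cofork.ofπ q w)) ∧
      ∀ ⦃Y X' S : C⦄ (f : Y ⟶ Q) (x : X' ⟶ X) (q' : X' ⟶ Y) (r : S ⟶ R) (d' c' : S ⟶ X')
        (w' : d' ≫ q' = c' ≫ q'),
        IsPullback x q' q f → IsPullback r (d' ≫ q') (d ≫ q) f →
        d' ≫ x = r ≫ d → c' ≫ x = r ≫ c →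
        Nonempty (IsColimit (Cofork.ofπ q' w'))

end Basic

section SemiLocalization

variable {X : Type*} [Category X] {C : Type*} [Category C]

/-- The left adjoint `L` of `U` is semi-left-exact if it preserves every pullback of a morphism
of the form `U f`, `f : A ⟶ L Q`, along a unit component `η_Q : Q ⟶ U (L Q)`. -/
def IsSemiLeftExact {L : C ⥤ X} {U : X ⥤ C} (adj : L ⊣ U) : Prop :=
  ∀ ⦃Q P : C⦄ ⦃A : X⦄ (f : A ⟶ L.obj Q) (a : P ⟶ Q) (b : P ⟶ U.obj A),
    IsPullback a b (adj.unit.app Q) (U.map f) →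
      IsPullback (L.map a) (L.map b) (L.map (adj.unit.app Q)) (L.map (U.map f))

/-- `U` exhibits `X` as a semi-localization of `C`: it is (up to equivalence) the inclusion of a
full reflective subcategory whose reflector is semi-left-exact. -/
def IsSemiLocalization (U : X ⥤ C) : Prop :=
  ∃ _ : Reflective U, IsSemiLeftExact (reflectorAdjunction U)

/-- A semi-localization all of whose unit components are regular epimorphisms. -/
def IsSemiLocalizationWithRegularEpiUnits (U : X ⥤ C) : Prop :=
  ∃ _ : Reflective U, IsSemiLeftExact (reflectorAdjunction U) ∧
    ∀ Q : C, IsRegularEpi ((reflectorAdjunction U).unit.app Q)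

end SemiLocalization

noncomputable section Relations

variable {C : Type u} [Category.{v} C] [Regular C]

/-- A relation from `X` to `Y` is a subobject of `X ⨯ Y`. -/
abbrev Relation (X Y : C) : Type max u v := Subobject (X ⨯ Y)

namespace Relation

variable {X Y Z T : C}

attribute [local simp] prod.lift_fst prod.lift_snd prod.lift_fst_assoc prod.lift_snd_assoc

/-- The graph of a morphism, as a relation. -/
def graph (f : X ⟶ Y) : Relation X Y :=
  Subobject.mk (prod.lift (𝟙 X) f)

/-- The opposite relation. -/
def op (R : Relation X Y) : Relation Y X :=
  Subobject.mk (R.arrow ≫ (prod.braiding X Y).hom)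

/-- The relation given by the image in `X ⨯ Y` of a span `X ⟵ M ⟶ Y`. -/
def ofSpan {M : C} (a : M ⟶ X) (b : M ⟶ Y) : Relation X Y :=
  imageSubobject (prod.lift a b)

/-- The composite of `R` followed by `S`: the image in `X ⨯ Z` of the pullback of `R` and `S`
over `Y`. -/
def comp (R : Relation X Y) (S : Relation Y Z) : Relation X Z :=
  ofSpan
    (pullback.fst (R.arrow ≫ prod.snd) (S.arrow ≫ prod.fst) ≫ R.arrow ≫ prod.fst)
    (pullback.snd (R.arrow ≫ prod.snd) (S.arrow ≫ prod.fst) ≫ S.arrow ≫ prod.snd)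

/-- The generalized elements `x` and `y` are related by `R`. -/
def Holds (R : Relation X Y) {W : C} (x : W ⟶ X) (y : W ⟶ Y) : Prop :=
  R.Factors (prod.lift x y)

lemma holds_iff {R : Relation X Y} {W : C} {x : W ⟶ X} {y : W ⟶ Y} :
    R.Holds x y ↔ ∃ g : W ⟶ (R : C), g ≫ R.arrow ≫ prod.fst = x ∧ g ≫ R.arrow ≫ prod.snd = y := by
  constructor
  · intro h
    have hg : R.factorThru (prod.lift x y) h ≫ R.arrow = prod.lift x y :=
      Subobject.factorThru_arrow _ _ _
    exact ⟨R.factorThru (prod.lift x y) h, by rw [reassoc_of% hg, prod.lift_fst],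
      by rw [reassoc_of% hg, prod.lift_snd]⟩
  · rintro ⟨g, rfl, rfl⟩
    have : prod.lift (g ≫ R.arrow ≫ prod.fst) (g ≫ R.arrow ≫ prod.snd) = g ≫ R.arrow := by
      ext <;> simp
    unfold Holds
    rw [this]
    exact Subobject.factors_comp_arrow g

lemma holds_mk_iff {M : C} {m : M ⟶ X ⨯ Y} [Mono m] {W : C} {x : W ⟶ X} {y : W ⟶ Y} :
    Holds (Subobject.mk m) x y ↔ ∃ g : W ⟶ M, g ≫ m ≫ prod.fst = x ∧ g ≫ m ≫ prod.snd = y := by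
  rw [holds_iff]
  constructor
  · rintro ⟨g, rfl, rfl⟩
    exact ⟨g ≫ (Subobject.underlyingIso m).hom, by simp, by simp⟩
  · rintro ⟨g, rfl, rfl⟩
    exact ⟨g ≫ (Subobject.underlyingIso m).inv, by simp, by simp⟩

lemma Holds.precomp {R : Relation X Y} {W W' : C} {x : W ⟶ X} {y : W ⟶ Y} (h : R.Holds x y)
    (e : W' ⟶ W) : R.Holds (e ≫ x) (e ≫ y) := by
  rw [holds_iff] at *
  obtain ⟨g, rfl, rfl⟩ := h
  exact ⟨e ≫ g, by simp, by simp⟩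

lemma holds_of_cover {R : Relation X Y} {W W' : C} {x : W ⟶ X} {y : W ⟶ Y}
    (e : W' ⟶ W) [StrongEpi e] (h : R.Holds (e ≫ x) (e ≫ y)) : R.Holds x y := by
  rw [holds_iff] at *
  obtain ⟨g, h1, h2⟩ := h
  have sq : CommSq g e R.arrow (prod.lift x y) :=
    ⟨by ext <;> simp [h1, h2]⟩
  exact ⟨sq.lift, by simp [← Category.assoc], by simp [← Category.assoc]⟩

lemma le_iff {R S : Relation X Y} :
    R ≤ S ↔ ∀ ⦃W : C⦄ (x : W ⟶ X) (y : W ⟶ Y), R.Holds x y → S.Holds x y := by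
  constructor
  · intro h W x y hR
    exact Subobject.factors_of_le _ h hR
  · intro h
    have h1 := h (R.arrow ≫ prod.fst) (R.arrow ≫ prod.snd) (by
      unfold Holds
      rw [← prod.comp_lift, prod.lift_fst_snd, Category.comp_id]
      exact Subobject.factors_self _)
    unfold Holds at h1
    rw [← prod.comp_lift, prod.lift_fst_snd, Category.comp_id] at h1
    exact Subobject.le_of_comm (S.factorThru _ h1) (by simp)

lemma holds_graph {f : X ⟶ Y} {W : C} {x : W ⟶ X} {y : W ⟶ Y} :
    (graph f).Holds x y ↔ x ≫ f = y := by
  unfold graph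
  rw [holds_mk_iff]
  simp

lemma holds_op {R : Relation X Y} {W : C} {x : W ⟶ X} {y : W ⟶ Y} :
    (op R).Holds y x ↔ R.Holds x y := by
  unfold op
  rw [holds_mk_iff, holds_iff]
  simp [and_comm]

lemma holds_ofSpan {M : C} {a : M ⟶ X} {b : M ⟶ Y} {W : C} {x : W ⟶ X} {y : W ⟶ Y} :
    (ofSpan a b).Holds x y ↔ ∃ (W' : C) (e : W' ⟶ W) (_ : StrongEpi e) (j : W' ⟶ M),
      j ≫ a = e ≫ x ∧ j ≫ b = e ≫ y := by
  unfold ofSpan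
  constructor
  · intro h
    obtain ⟨t, ht1, ht2⟩ := holds_iff.1 h
    have hse : StrongEpi (factorThruImageSubobject (prod.lift a b)) := by
      unfold factorThruImageSubobject
      infer_instance
    have hk : StrongEpi (pullback.snd (factorThruImageSubobject (prod.lift a b)) t) :=
      inferInstance
    have hj : pullback.fst (factorThruImageSubobject (prod.lift a b)) t ≫ prod.lift a b =
        pullback.snd (factorThruImageSubobject (prod.lift a b)) t ≫ t ≫
          (imageSubobject (prod.lift a b)).arrow := by
      rw [← pullback.condition_assoc, imageSubobject_arrow_comp]
    have h1 := congr($hj ≫ prod.fst)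
    have h2 := congr($hj ≫ prod.snd)
    simp only [Category.assoc, prod.lift_fst, prod.lift_snd] at h1 h2
    rw [ht1] at h1
    rw [ht2] at h2
    exact ⟨_, _, hk, _, h1, h2⟩
  · rintro ⟨W', e, he, j, h1, h2⟩
    refine holds_of_cover e ?_
    rw [holds_iff]
    refine ⟨j ≫ factorThruImageSubobject _, ?_, ?_⟩ <;> simp [h1, h2]

lemma holds_comp {R : Relation X Y} {S : Relation Y Z} {W : C} {x : W ⟶ X} {z : W ⟶ Z} :
    (comp R S).Holds x z ↔ ∃ (W' : C) (e : W' ⟶ W) (_ : StrongEpi e) (y : W' ⟶ Y),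
      R.Holds (e ≫ x) y ∧ S.Holds y (e ≫ z) := by
  unfold comp
  rw [holds_ofSpan]
  simp only [holds_iff]
  constructor
  · rintro ⟨W', e, he, j, h1, h2⟩
    exact ⟨W', e, he, j ≫ pullback.fst _ _ ≫ R.arrow ≫ prod.snd,
      ⟨j ≫ pullback.fst _ _, by simpa using h1, by simp⟩,
      ⟨j ≫ pullback.snd _ _, by simp [pullback.condition], by simpa using h2⟩⟩
  · rintro ⟨W', e, he, y, ⟨a, ha1, ha2⟩, ⟨b, hb1, hb2⟩⟩
    refine ⟨W', e, he, pullback.lift a b (by rw [ha2, hb1]), ?_, ?_⟩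
    · rw [pullback.lift_fst_assoc, ha1]
    · rw [pullback.lift_snd_assoc, hb2]

lemma comp_mono {R R' : Relation X Y} {S S' : Relation Y Z} (h : R ≤ R') (h' : S ≤ S') :
    comp R S ≤ comp R' S' := by
  rw [le_iff] at *
  simp only [holds_comp]
  rintro W x z ⟨W', e, he, y, h1, h2⟩
  exact ⟨W', e, he, y, h _ _ h1, h' _ _ h2⟩

lemma op_comp (R : Relation X Y) (S : Relation Y Z) : op (comp R S) = comp (op S) (op R) := by
  apply le_antisymm <;> rw [le_iff] <;> simp only [holds_comp, holds_op] <;>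
    exact fun W x z ⟨W', e, he, y, h1, h2⟩ => ⟨W', e, he, y, h2, h1⟩

lemma comp_assoc (R : Relation X Y) (S : Relation Y Z) (Q : Relation Z T) :
    comp (comp R S) Q = comp R (comp S Q) := by
  apply le_antisymm <;> rw [le_iff] <;> intro W x t h <;> rw [holds_comp] at h ⊢ <;>
    simp only [holds_comp] at h ⊢
  · obtain ⟨W', e, he, z, ⟨W'', e', he', y, h1, h2⟩, h3⟩ := h
    exact ⟨W'', e' ≫ e, strongEpi_comp _ _, y, by simpa using h1,
      W'', 𝟙 _, inferInstance, e' ≫ z, by simpa using h2, by simpa using h3.precomp e'⟩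
  · obtain ⟨W', e, he, y, h1, ⟨W'', e', he', z, h2, h3⟩⟩ := h
    exact ⟨W'', e' ≫ e, strongEpi_comp _ _, z,
      ⟨W'', 𝟙 _, inferInstance, e' ≫ y, by simpa using h1.precomp e', by simpa using h2⟩,
      by simpa using h3⟩

lemma graph_id_comp (R : Relation X Y) : comp (graph (𝟙 X)) R = R := by
  apply le_antisymm <;> rw [le_iff] <;> intro W x y h
  · rw [holds_comp] at h
    obtain ⟨W', e, he, z, h1, h2⟩ := h
    rw [holds_graph, Category.comp_id] at h1
    subst h1
    exact holds_of_cover e h2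
  · rw [holds_comp]
    exact ⟨W, 𝟙 _, inferInstance, x, by simp [holds_graph], by simpa using h⟩

lemma comp_graph_id (R : Relation X Y) : comp R (graph (𝟙 Y)) = R := by
  apply le_antisymm <;> rw [le_iff] <;> intro W x y h
  · rw [holds_comp] at h
    obtain ⟨W', e, he, z, h1, h2⟩ := h
    rw [holds_graph, Category.comp_id] at h2
    subst h2
    exact holds_of_cover e h1
  · rw [holds_comp]
    exact ⟨W, 𝟙 _, inferInstance, y, by simpa using h, by simp [holds_graph]⟩

lemma graph_comp (f : X ⟶ Y) (g : Y ⟶ Z) : graph (f ≫ g) = comp (graph f) (graph g) := by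
  apply le_antisymm <;> rw [le_iff] <;> intro W x z h
  · rw [holds_comp]
    rw [holds_graph] at h
    exact ⟨W, 𝟙 _, inferInstance, x ≫ f, by simp [holds_graph], by simpa [holds_graph] using h⟩
  · rw [holds_comp] at h
    obtain ⟨W', e, he, y, h1, h2⟩ := h
    rw [holds_graph] at h1 h2 ⊢
    rw [← cancel_epi e, ← h2, ← h1]
    simp

lemma graph_total (f : X ⟶ Y) : graph (𝟙 X) ≤ comp (graph f) (op (graph f)) := by
  rw [le_iff]
  intro W x x' h
  rw [holds_graph, Category.comp_id] at h
  subst h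
  rw [holds_comp]
  exact ⟨W, 𝟙 _, inferInstance, x ≫ f, by simp [holds_graph], by simp [holds_op, holds_graph]⟩

lemma graph_singleValued (f : X ⟶ Y) : comp (op (graph f)) (graph f) ≤ graph (𝟙 Y) := by
  rw [le_iff]
  intro W y y' h
  rw [holds_comp] at h
  obtain ⟨W', e, he, x, h1, h2⟩ := h
  rw [holds_op, holds_graph] at h1
  rw [holds_graph] at h2 ⊢
  rw [Category.comp_id, ← cancel_epi e, ← h2, ← h1]

lemma op_mono {R S : Relation X Y} (h : R ≤ S) : op R ≤ op S := by
  rw [le_iff] at *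
  intro W x y
  rw [holds_op, holds_op]
  exact h _ _

lemma op_graph_id : op (graph (𝟙 X)) = graph (𝟙 X) := by
  apply le_antisymm <;> rw [le_iff] <;> intro W x y h <;>
    simpa [holds_op, holds_graph, eq_comm] using h

/-- A binary relation is an equivalence relation if it is reflexive, symmetric and transitive. -/
structure IsEquiv (R : Relation X X) : Prop where
  refl : graph (𝟙 X) ≤ R
  symm : R ≤ op R
  trans : comp R R ≤ R

lemma IsEquiv.comp_self {R : Relation X X} (h : R.IsEquiv) : comp R R = R :=
  le_antisymm h.trans ((comp_graph_id R).symm.le.trans (comp_mono le_rfl h.refl))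

lemma IsEquiv.op_eq {R : Relation X X} (h : R.IsEquiv) : op R = R := by
  refine le_antisymm ?_ h.symm
  rw [le_iff]
  intro W x y hxy
  rw [holds_op] at hxy
  exact holds_op.1 (le_iff.1 h.symm _ _ hxy)

lemma isEquiv_graph_id (X : C) : (graph (𝟙 X)).IsEquiv where
  refl := le_rfl
  symm := op_graph_id.symm.le
  trans := (comp_graph_id _).le

end Relation

variable (C) in
/-- The exact completion of a regular category as a regular category (the ex/reg completion).
Its objects are the equivalence relations in `C`, the objects of the bicategory obtained from
relations in `C` by splitting the equivalence relations. -/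
structure ExReg : Type max u v where
  carrier : C
  rel : Relation carrier carrier
  isEquiv : rel.IsEquiv

namespace ExReg

/-- A morphism of the ex/reg completion is a map (a total and single-valued morphism) in the
bicategory obtained from relations by splitting the equivalence relations; recall that the identity
of `A` in that bicategory is the relation `A.rel`. -/
@[ext]
structure Hom (A B : ExReg C) : Type max u v where
  rel : Relation A.carrier B.carrier
  source_comp : Relation.comp A.rel rel = rel
  comp_target : Relation.comp rel B.rel = rel
  total : A.rel ≤ Relation.comp rel (Relation.op rel)
  singleValued : Relation.comp (Relation.op rel) rel ≤ B.rel

/-- The identity of `A` is the equivalence relation `A.rel`. -/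
def Hom.id (A : ExReg C) : Hom A A where
  rel := A.rel
  source_comp := A.isEquiv.comp_self
  comp_target := A.isEquiv.comp_self
  total := by rw [A.isEquiv.op_eq, A.isEquiv.comp_self]
  singleValued := by rw [A.isEquiv.op_eq, A.isEquiv.comp_self]

/-- Composition of morphisms is composition of relations. -/
def Hom.comp {A B D : ExReg C} (F : Hom A B) (G : Hom B D) : Hom A D where
  rel := Relation.comp F.rel G.rel
  source_comp := by rw [← Relation.comp_assoc, F.source_comp]
  comp_target := by rw [Relation.comp_assoc, G.comp_target]
  total := by
    rw [Relation.op_comp, Relation.comp_assoc, ← Relation.comp_assoc G.rel]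
    refine F.total.trans (Relation.comp_mono le_rfl ?_)
    conv_lhs => rw [← F.comp_target, Relation.op_comp, B.isEquiv.op_eq]
    exact Relation.comp_mono G.total le_rfl
  singleValued := by
    rw [Relation.op_comp, Relation.comp_assoc, ← Relation.comp_assoc (Relation.op F.rel)]
    refine le_trans (Relation.comp_mono le_rfl ?_) G.singleValued
    conv_rhs => rw [← G.source_comp]
    exact Relation.comp_mono F.singleValued le_rfl

instance : Category.{max u v} (ExReg C) where
  Hom := Hom
  id := Hom.id
  comp := Hom.comp
  id_comp F := Hom.ext F.source_comp
  comp_id F := Hom.ext F.comp_target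
  assoc F G H := Hom.ext (Relation.comp_assoc F.rel G.rel H.rel)

variable (C) in
/-- The canonical functor from a regular category to its ex/reg completion, sending `X` to the
identity relation on `X` and a morphism to its graph. -/
def embedding : C ⥤ ExReg C where
  obj X := ⟨X, Relation.graph (𝟙 X), Relation.isEquiv_graph_id X⟩
  map f :=
    { rel := Relation.graph f
      source_comp := Relation.graph_id_comp _
      comp_target := Relation.comp_graph_id _
      total := Relation.graph_total f
      singleValued := Relation.graph_singleValued f }
  map_id _ := rfl
  map_comp f g := Hom.ext (Relation.graph_comp f g)

end ExReg

end Relations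

end SemiLoc

namespace SemiLoc

/-! ### Stable coequalizers of equivalence relations, and regularity. -/

section Coequalizers

variable {C : Type*} [Category C]

/-! Both directions rest on one computation: in a semi-localization `X` of `C`, the coequalizer of
an equivalence relation is the reflection of its coequalizer `q` in `C`, so it has the form `η ∘ q`.

From (b) to (a): an exact category has stable coequalizers of equivalence relations. Pulling `η ∘ q`
back along a morphism of `X` amounts to pulling back `η` and then `q`. The second is stable in `C`;
the first is still inverted by the reflector, which is exactly semi-left-exactness
(`IsSemiLocalization.hasStableCoequalizers`). Protomodularity descends along a fully faithful
functor preserving pullbacks, and regularity follows from stable coequalizers applied to kernel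
pairs. Condition (d) is a special case of (b), since the ex/reg completion is exact.

From (a) to (c) and (d): only a few features of `X → X_ex/reg` matter, collected in
`IsCoveringEmbedding`. For a cover `q : I A ⟶ Q`, the kernel pair of `q` embeds in `I (A ⨯ A)`,
hence lies in `X`; its coequalizer there is the reflection of `Q`, and stability of this coequalizer
gives semi-left-exactness. The unit is a regular epimorphism because its composite with `q` is the
image of a regular epimorphism of `X`. Protomodularity passes to the completion by covering a split
epimorphism by one in `X` and pulling subobjects back along the cover.

That the completion is exact and receives a covering embedding is proved with generalized elements:
relations are tested on elements of the carriers, existence being local, that is, up to a strong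
epimorphism. -/

lemma nonempty_isColimit_cofork {R X Q : C} {d c : R ⟶ X} {q : X ⟶ Q} (w : d ≫ q = c ≫ q)
    (hex : ∀ ⦃Z : C⦄ (k : X ⟶ Z), d ≫ k = c ≫ k → ∃ l : Q ⟶ Z, q ≫ l = k)
    (hepi : ∀ ⦃Z : C⦄ (a b : Q ⟶ Z), q ≫ a = q ≫ b → a = b) :
    Nonempty (IsColimit (Cofork.ofπ q w)) := by
  choose l hl using hex
  exact ⟨Cofork.IsColimit.mk _ (fun s => l s.π s.condition) (fun s => hl _ _)
    (fun s m hm => hepi _ _ (hm.trans (hl _ _).symm))⟩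

lemma exists_desc_of_isColimit {R X Q : C} {d c : R ⟶ X} {q : X ⟶ Q} {w : d ≫ q = c ≫ q}
    (h : Nonempty (IsColimit (Cofork.ofπ q w))) {Z : C} (k : X ⟶ Z) (hk : d ≫ k = c ≫ k) :
    ∃ l : Q ⟶ Z, q ≫ l = k :=
  ⟨h.some.desc (Cofork.ofπ k hk), Cofork.IsColimit.π_desc h.some⟩

lemma hom_ext_of_isColimit {R X Q : C} {d c : R ⟶ X} {q : X ⟶ Q} {w : d ≫ q = c ≫ q}
    (h : Nonempty (IsColimit (Cofork.ofπ q w))) {Z : C} {a b : Q ⟶ Z} (hab : q ≫ a = q ≫ b) :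
    a = b :=
  Cofork.IsColimit.hom_ext h.some hab

lemma isRegularEpi_of_isColimit {R X Q : C} {d c : R ⟶ X} {q : X ⟶ Q} {w : d ≫ q = c ≫ q}
    (h : Nonempty (IsColimit (Cofork.ofπ q w))) : IsRegularEpi q :=
  ⟨⟨⟨_, _, _, w, h.some⟩⟩⟩

/-- A jointly monic pair is an equivalence relation as soon as it is reflexive, symmetric, and
transitive on generalized elements. -/
lemma isEquivalenceRelation_of_elements [HasPullbacks C] {R X : C} {d c : R ⟶ X}
    (hmono : ∀ ⦃W : C⦄ (a b : W ⟶ R), a ≫ d = b ≫ d → a ≫ c = b ≫ c → a = b)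
    (r : X ⟶ R) (hr₁ : r ≫ d = 𝟙 X) (hr₂ : r ≫ c = 𝟙 X)
    (s : R ⟶ R) (hs₁ : s ≫ d = c) (hs₂ : s ≫ c = d)
    (ht : ∀ ⦃W : C⦄ (a b : W ⟶ R), a ≫ c = b ≫ d → ∃ t : W ⟶ R, t ≫ d = a ≫ d ∧ t ≫ c = b ≫ c) :
    IsEquivalenceRelation d c := by
  obtain ⟨t, ht₁, ht₂⟩ := ht (pullback.fst c d) (pullback.snd c d) pullback.condition
  exact ⟨⟨{ right_cancellation := hmono, r := r, s := s
            reflexivity₁ := hr₁, reflexivity₂ := hr₂, symmetry₁ := hs₁, symmetry₂ := hs₂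
            c := _, isLimit := pullback.isLimit c d, t := t
            transitivity₁ := ht₁, transitivity₂ := ht₂ }⟩⟩

lemma isEquivalenceRelation_of_isKernelPair [HasPullbacks C] {R X Y : C} {f : X ⟶ Y}
    {d c : R ⟶ X} (h : IsKernelPair f d c) : IsEquivalenceRelation d c :=
  ⟨⟨h.equivalenceRelation f d c (pullback.isLimit c d)⟩⟩

/-- Preservation of pullbacks carries over the transitivity datum. Joint monicity is asked for
separately; for a right adjoint it is `map_jointly_mono`. -/
lemma isEquivalenceRelation_map {D : Type*} [Category D] (F : C ⥤ D)
    [PreservesLimitsOfShape WalkingCospan F] {R X : C} {d c : R ⟶ X}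
    (h : IsEquivalenceRelation d c)
    (hmono : ∀ ⦃W : D⦄ (a b : W ⟶ F.obj R), a ≫ F.map d = b ≫ F.map d →
      a ≫ F.map c = b ≫ F.map c → a = b) :
    IsEquivalenceRelation (F.map d) (F.map c) := by
  obtain ⟨⟨e⟩⟩ := h
  have : JointlyMono₂ (F.map d) (F.map c) := ⟨hmono⟩
  exact ⟨⟨{ e.toReflexiveRelation.map F, e.toSymmetricRelation.map F,
    e.toTransitiveRelation.map F with }⟩⟩

/-- In a category with stable coequalizers of equivalence relations, any coequalizer of an
equivalence relation is stable under pullback. -/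
lemma HasStableCoequalizersOfEquivalenceRelations.exists_isColimit_of_isPullback [HasPullbacks C]
    (h : HasStableCoequalizersOfEquivalenceRelations C) {R X Q : C} {d c : R ⟶ X}
    (hdc : IsEquivalenceRelation d c) {q : X ⟶ Q} {w : d ≫ q = c ≫ q}
    (hq : Nonempty (IsColimit (Cofork.ofπ q w))) {Y X' : C} {f : Y ⟶ Q} {x : X' ⟶ X}
    {q' : X' ⟶ Y} (sq : IsPullback x q' q f) :
    ∃ (S : C) (r : S ⟶ R) (d' c' : S ⟶ X') (w' : d' ≫ q' = c' ≫ q'),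
      d' ≫ x = r ≫ d ∧ c' ≫ x = r ≫ c ∧ Nonempty (IsColimit (Cofork.ofπ q' w')) := by
  obtain ⟨Q₀, q₀, w₀, hq₀, hst⟩ := h d c hdc
  -- Stability is known only for the coequalizer `q₀` provided by `h`; the given one differs from it
  -- by an isomorphism.
  obtain ⟨e, rfl⟩ : ∃ e : Q ≅ Q₀, q ≫ e.hom = q₀ := by
    obtain ⟨l, hl⟩ := exists_desc_of_isColimit hq₀ q w
    obtain ⟨m, hm⟩ := exists_desc_of_isColimit hq q₀ w₀
    exact ⟨{ hom := m, inv := l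
             hom_inv_id := hom_ext_of_isColimit hq (by rw [reassoc_of% hm, hl, Category.comp_id])
             inv_hom_id := hom_ext_of_isColimit hq₀
              (by rw [reassoc_of% hl, hm, Category.comp_id]) }, hm⟩
  have sq' : IsPullback x q' (q ≫ e.hom) (f ≫ e.hom) := by
    simpa using sq.paste_vert
      (IsPullback.of_vert_isIso (fst := f) (snd := 𝟙 _) (f := e.hom) (g := f ≫ e.hom) ⟨by simp⟩)
  let d' := sq'.lift (pullback.fst (d ≫ q ≫ e.hom) (f ≫ e.hom) ≫ d)
    (pullback.snd _ _) (by simpa using pullback.condition)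
  let c' := sq'.lift (pullback.fst (d ≫ q ≫ e.hom) (f ≫ e.hom) ≫ c)
    (pullback.snd _ _) (by simpa [← w₀] using pullback.condition)
  have hd' : d' ≫ q' = pullback.snd _ _ := sq'.lift_snd _ _ _
  have hc' : c' ≫ q' = pullback.snd _ _ := sq'.lift_snd _ _ _
  exact ⟨_, pullback.fst _ _, d', c', hd'.trans hc'.symm, sq'.lift_fst _ _ _, sq'.lift_fst _ _ _,
    hst (f ≫ e.hom) x q' _ d' c' (hd'.trans hc'.symm) sq'
      (by rw [hd']; exact IsPullback.of_hasPullback _ _) (sq'.lift_fst _ _ _) (sq'.lift_fst _ _ _)⟩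

/-- Kernel pairs are equivalence relations, and a regular epimorphism is the coequalizer of its
kernel pair, so its pullbacks are again coequalizers. -/
lemma regular_of_hasStableCoequalizers {C : Type u} [Category.{v} C] [HasFiniteLimits C]
    (h : HasStableCoequalizersOfEquivalenceRelations C) : Regular C where
  hasCoequalizer_of_isKernelPair hk := by
    obtain ⟨Q, q, w, ⟨hq⟩, -⟩ := h _ _ (isEquivalenceRelation_of_isKernelPair hk)
    exact ⟨⟨_, hq⟩⟩
  regularEpiIsStableUnderBaseChange := by
    constructor
    intro Y X S X' f p f' p' sq (hp : IsRegularEpi p)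
    have hk := IsKernelPair.of_hasPullback p
    obtain ⟨T, r, d', c', w', -, -, hp'⟩ := h.exists_isColimit_of_isPullback
      (isEquivalenceRelation_of_isKernelPair hk) (w := hk.w) ⟨hk.toCoequalizer'⟩ sq
    exact isRegularEpi_of_isColimit hp'

/-- Pulling back a kernel pair along a morphism into the codomain yields a kernel pair. -/
lemma isKernelPair_of_isPullback {R X Q Y X' S : C} {d c : R ⟶ X} {q : X ⟶ Q}
    (hk : IsKernelPair q d c) {f : Y ⟶ Q} {x : X' ⟶ X} {q' : X' ⟶ Y} {r : S ⟶ R}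
    {d' c' : S ⟶ X'} (w' : d' ≫ q' = c' ≫ q') (sq : IsPullback x q' q f)
    (sq' : IsPullback r (d' ≫ q') (d ≫ q) f) (hd : d' ≫ x = r ≫ d) (hc : c' ≫ x = r ≫ c) :
    IsKernelPair q' d' c' := by
  refine ⟨⟨w'⟩, ⟨PullbackCone.isLimitAux' _ fun s => ?_⟩⟩
  have hs : s.fst ≫ q' = s.snd ≫ q' := s.condition
  -- Two elements of `X'` over the same element of `Y` have images in `X` that agree in `Q`, hence
  -- define an element of `R`; with the element of `Y` it gives one of `S`.
  have h₁ : (s.fst ≫ x) ≫ q = (s.snd ≫ x) ≫ q := by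
    simp only [Category.assoc, sq.w, reassoc_of% hs]
  have h₂ : hk.lift _ _ h₁ ≫ d ≫ q = (s.fst ≫ q') ≫ f := by
    rw [IsKernelPair.lift_fst_assoc, Category.assoc, Category.assoc, sq.w]
  have e₁ := sq'.lift_fst _ _ h₂
  have e₂ := sq'.lift_snd _ _ h₂
  refine ⟨sq'.lift _ _ h₂, ?_, ?_, ?_⟩
  · refine sq.hom_ext ?_ ?_
    · change (_ ≫ d') ≫ x = _
      rw [Category.assoc, hd, reassoc_of% e₁, IsKernelPair.lift_fst]
    · change (_ ≫ d') ≫ q' = _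
      rw [Category.assoc, e₂]
  · refine sq.hom_ext ?_ ?_
    · change (_ ≫ c') ≫ x = _
      rw [Category.assoc, hc, reassoc_of% e₁, IsKernelPair.lift_snd]
    · change (_ ≫ c') ≫ q' = _
      rw [Category.assoc, ← w', e₂, hs]
  · intro (m : s.pt ⟶ S) (hm₁ : m ≫ d' = s.fst) (hm₂ : m ≫ c' = s.snd)
    refine sq'.hom_ext ?_ ?_
    · rw [e₁]
      refine hk.hom_ext ?_ ?_
      · rw [IsKernelPair.lift_fst, Category.assoc, ← hd, reassoc_of% hm₁]
      · rw [IsKernelPair.lift_snd, Category.assoc, ← hc, reassoc_of% hm₂]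
    · rw [e₂, reassoc_of% hm₁]

/-- The relation is the kernel pair of its coequalizer. Pullback preserves both kernel pairs and
regular epimorphisms, and a regular epimorphism is the coequalizer of its kernel pair. -/
lemma IsBarrExact.hasStableCoequalizers {C : Type u} [Category.{v} C] (h : IsBarrExact C) :
    HasStableCoequalizersOfEquivalenceRelations C := by
  intro R X d c hdc
  have := h.regular
  obtain ⟨Q₀, q₀, hk₀⟩ := h.effective d c hdc
  have := Regular.hasCoequalizer_of_isKernelPair hk₀
  -- `q₀` factors through the coequalizer, which therefore identifies no more than `q₀` does.
  have hk : IsKernelPair (coequalizer.π d c) d c :=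
    IsKernelPair.cancel_right (f₂ := coequalizer.desc q₀ hk₀.w) (coequalizer.condition d c)
      (by simpa using hk₀)
  refine ⟨_, coequalizer.π d c, coequalizer.condition d c, ⟨coequalizerIsCoequalizer d c⟩, ?_⟩
  intro Y X' S f x q' r d' c' w' sq sq' hd hc
  have : IsRegularEpi q' :=
    Regular.regularEpiIsStableUnderBaseChange.of_isPullback sq
      (inferInstanceAs (IsRegularEpi (coequalizer.π d c)))
  exact ⟨(isKernelPair_of_isPullback hk w' sq sq' hd hc).toCoequalizer'⟩

end Coequalizers

/-! ### What a semi-localization inherits from the ambient category. -/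

section Reflections

variable {X : Type*} [Category X] {C : Type*} [Category C] {L : C ⥤ X} {U : X ⥤ C}

/-- Yoneda in `X`, transposed along the adjunction. It turns invertibility of `L b` into a universal
property of `b` inside `C`. -/
lemma isIso_map_iff_bijective_precomp (adj : L ⊣ U) {P Q : C} (b : P ⟶ Q) :
    IsIso (L.map b) ↔
      ∀ Z : X, Function.Bijective (fun h : Q ⟶ U.obj Z => b ≫ h) := by
  rw [isIso_iff_coyoneda_map_bijective]
  refine forall_congr' fun Z => ?_
  have : (fun h : Q ⟶ U.obj Z => b ≫ h) =
      (adj.homEquiv P Z) ∘ (fun x => L.map b ≫ x) ∘ (adj.homEquiv Q Z).symm := by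
    funext h
    simp [Adjunction.homEquiv_naturality_left]
  rw [this, Equiv.comp_bijective, Equiv.bijective_comp]

lemma isIso_map_unit_app (adj : L ⊣ U) [U.Full] [U.Faithful] (Q : C) :
    IsIso (L.map (adj.unit.app Q)) := by
  have : IsIso (L.map (adj.unit.app Q) ≫ adj.counit.app (L.obj Q)) := by
    rw [adj.left_triangle_components Q]
    exact IsIso.id _
  exact IsIso.of_isIso_comp_right _ (adj.counit.app (L.obj Q))

/-- The reflector inverts the pullback of a unit component along a morphism of the
subcategory. -/
lemma IsSemiLeftExact.isIso_map_snd {adj : L ⊣ U} [U.Full] [U.Faithful]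
    (h : IsSemiLeftExact adj) {Q P : C} {A : X} {f : A ⟶ L.obj Q} {a : P ⟶ Q} {b : P ⟶ U.obj A}
    (sq : IsPullback a b (adj.unit.app Q) (U.map f)) : IsIso (L.map b) := by
  have := isIso_map_unit_app adj Q
  exact (h f a b sq).isIso_snd_of_isIso

/-- `L` always inverts the unit, so once `L b` is invertible the image square has two parallel
isomorphisms as sides and is a pullback. -/
lemma isSemiLeftExact_of_isIso {adj : L ⊣ U} [U.Full] [U.Faithful]
    (h : ∀ ⦃Q P : C⦄ ⦃A : X⦄ (f : A ⟶ L.obj Q) (a : P ⟶ Q) (b : P ⟶ U.obj A),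
      IsPullback a b (adj.unit.app Q) (U.map f) → IsIso (L.map b)) : IsSemiLeftExact adj := by
  intro Q P A f a b sq
  have := isIso_map_unit_app adj Q
  have := h f a b sq
  exact IsPullback.of_vert_isIso ⟨by rw [← L.map_comp, ← L.map_comp, sq.w]⟩

lemma IsSemiLocalization.hasFiniteLimits [HasFiniteLimits C] (h : IsSemiLocalization U) :
    HasFiniteLimits X := by
  obtain ⟨_, -⟩ := h
  exact ⟨fun J _ _ => hasLimitsOfShape_of_reflective U⟩

/-- Transposition reduces test objects of `C` to their reflections in `X`. -/
lemma map_jointly_mono (adj : L ⊣ U) {R A B : X} {d : R ⟶ A} {c : R ⟶ B}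
    (h : ∀ ⦃W : X⦄ (a b : W ⟶ R), a ≫ d = b ≫ d → a ≫ c = b ≫ c → a = b)
    ⦃W : C⦄ (a b : W ⟶ U.obj R) (h₁ : a ≫ U.map d = b ≫ U.map d)
    (h₂ : a ≫ U.map c = b ≫ U.map c) : a = b := by
  apply (adj.homEquiv W R).symm.injective
  apply h
  · rw [← Adjunction.homEquiv_naturality_right_symm, h₁,
      Adjunction.homEquiv_naturality_right_symm]
  · rw [← Adjunction.homEquiv_naturality_right_symm, h₂,
      Adjunction.homEquiv_naturality_right_symm]

/-- `U` preserves pullbacks and monomorphisms, and being fully faithful it lets the fillers found in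
`C` be lifted to `X`. -/
lemma IsSemiLocalization.isProtomodular {X : Type u} [Category.{v} X] {C : Type*} [Category C]
    {U : X ⥤ C} (h : IsSemiLocalization U) (hC : IsProtomodular C) :
    IsProtomodular X := by
  obtain ⟨_, -⟩ := h
  have := hC.hasPullbacks
  have : PreservesLimitsOfShape WalkingCospan U :=
    (reflectorAdjunction U).rightAdjoint_preservesLimits.preservesLimitsOfShape
  refine ⟨hasLimitsOfShape_of_reflective U, fun D E A B g q p f s sq hs => ?_⟩
  have hj := hC.jointlyStrongEpi _ _ _ _ (U.map s) (sq.map U) (by rw [← U.map_comp, hs, U.map_id])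
  constructor
  · intro T a b ha hb
    apply U.map_injective
    apply hj.hom_ext
    · rw [← U.map_comp, ha, U.map_comp]
    · rw [← U.map_comp, hb, U.map_comp]
  · intro M N m _ a b t ha hb
    obtain ⟨l, h₁, h₂, h₃⟩ := hj.exists_lift (U.map m) (U.map a) (U.map b) (U.map t)
      (by rw [← U.map_comp, ha, U.map_comp]) (by rw [← U.map_comp, hb, U.map_comp])
    refine ⟨U.preimage l, ?_, ?_, ?_⟩ <;> apply U.map_injective <;> simpa

/-- The coequalizer in `X` is `q ≫ η`, with `q` the coequalizer in `C`: maps into objects of `X` see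
no difference between `Q` and its reflection. -/
lemma IsSemiLocalization.hasStableCoequalizers [HasFiniteLimits C] (h : IsSemiLocalization U)
    (hC : HasStableCoequalizersOfEquivalenceRelations C) :
    HasStableCoequalizersOfEquivalenceRelations X := by
  obtain ⟨_, hsle⟩ := h
  have : PreservesLimitsOfShape WalkingCospan U :=
    (reflectorAdjunction U).rightAdjoint_preservesLimits.preservesLimitsOfShape
  intro R A d c hdc
  have hmono : ∀ ⦃W : X⦄ (a b : W ⟶ R), a ≫ d = b ≫ d → a ≫ c = b ≫ c → a = b := by
    obtain ⟨⟨e⟩⟩ := hdc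
    exact fun W a b => e.right_cancellation a b
  obtain ⟨Q, q, w, hq, hst⟩ := hC (U.map d) (U.map c)
    (isEquivalenceRelation_map U hdc (map_jointly_mono (reflectorAdjunction U) hmono))
  set adj := reflectorAdjunction U with hadj
  let η := adj.unit.app Q
  let π : A ⟶ (reflector U).obj Q := U.preimage (q ≫ η)
  have hπ : U.map π = q ≫ η := U.map_preimage _
  have hη : ∀ Z : X, Function.Bijective
      (fun h : U.obj ((reflector U).obj Q) ⟶ U.obj Z => η ≫ h) :=
    (isIso_map_iff_bijective_precomp adj η).1 (isIso_map_unit_app adj Q)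
  have hw : d ≫ π = c ≫ π := U.map_injective (by simp [hπ, reassoc_of% w])
  refine ⟨_, π, hw, nonempty_isColimit_cofork hw ?_ ?_, ?_⟩
  · intro Z k hk
    obtain ⟨l, hl⟩ := exists_desc_of_isColimit hq (U.map k)
      (by rw [← U.map_comp, hk, U.map_comp])
    obtain ⟨l', hl'⟩ := (hη Z).2 l
    refine ⟨U.preimage l', U.map_injective ?_⟩
    dsimp only at hl'
    rw [U.map_comp, hπ, U.map_preimage, Category.assoc, hl', hl]
  · intro Z a b hab
    apply U.map_injective
    apply (hη Z).1
    apply hom_ext_of_isColimit hq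
    dsimp only
    rw [← Category.assoc, ← Category.assoc, ← hπ, ← U.map_comp, hab, U.map_comp]
  · intro Y X' S f x q' r d' c' w' sq sq' hd hc
    have sqP : IsPullback (pullback.fst η (U.map f)) (pullback.snd η (U.map f)) η (U.map f) :=
      IsPullback.of_hasPullback _ _
    -- The only use of semi-left-exactness: the pullback of `η` along `U f` is still universal for
    -- maps into objects of `X`.
    have hb := (isIso_map_iff_bijective_precomp adj _).1 (hsle.isIso_map_snd sqP)
    have sqU := sq.map U
    rw [hπ] at sqU
    -- By pasting, `t` is the pullback of `q` along the projection to `Q`, hence a coequalizer in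
    -- `C` by stability there.
    let t := sqP.lift (U.map x ≫ q) (U.map q') (by rw [Category.assoc, sqU.w])
    have ht₁ : t ≫ pullback.fst η (U.map f) = U.map x ≫ q := sqP.lift_fst _ _ _
    have ht₂ : t ≫ pullback.snd η (U.map f) = U.map q' := sqP.lift_snd _ _ _
    have sqU' := sq'.map U
    rw [U.map_comp, U.map_comp, hπ, ← ht₂] at sqU'
    have e₁ : U.map d' ≫ t = U.map c' ≫ t := by
      apply sqP.hom_ext
      · rw [Category.assoc, Category.assoc, ht₁, ← U.map_comp_assoc, ← U.map_comp_assoc, hd, hc,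
          U.map_comp_assoc, U.map_comp_assoc, w]
      · rw [Category.assoc, Category.assoc, ht₂, ← U.map_comp, ← U.map_comp, w']
    have hT := hst (pullback.fst η (U.map f)) (U.map x) t (U.map r) (U.map d') (U.map c') e₁
      (IsPullback.of_bot (by rwa [ht₂]) ht₁.symm sqP)
      (IsPullback.of_bot (by simpa only [Category.assoc] using sqU') (by
        rw [Category.assoc, ht₁, ← U.map_comp_assoc, ← U.map_comp_assoc, hd]) sqP)
      (by rw [← U.map_comp, hd, U.map_comp]) (by rw [← U.map_comp, hc, U.map_comp])
    apply nonempty_isColimit_cofork w'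
    · intro Z k hk
      obtain ⟨l, hl⟩ := exists_desc_of_isColimit hT (U.map k)
        (by rw [← U.map_comp, hk, U.map_comp])
      obtain ⟨l', hl'⟩ := (hb Z).2 l
      refine ⟨U.preimage l', U.map_injective ?_⟩
      dsimp only at hl'
      rw [U.map_comp, U.map_preimage, ← ht₂, Category.assoc, hl', hl]
    · intro Z a b hab
      apply U.map_injective
      apply (hb Z).1
      apply hom_ext_of_isColimit hT
      dsimp only
      rw [← Category.assoc, ← Category.assoc, ht₂, ← U.map_comp, hab, U.map_comp]

/-- A semi-localization of an exact protomodular category is regular and protomodular, and has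
stable coequalizers of equivalence relations. -/
lemma IsSemiLocalization.regular_protomodular_stable {X : Type u} [Category.{v} X]
    {C : Type w₁} [Category.{w₂} C] {U : X ⥤ C} (h : IsSemiLocalization U) (hC : IsBarrExact C)
    (hC' : IsProtomodular C) :
    Regular X ∧ IsProtomodular X ∧ HasStableCoequalizersOfEquivalenceRelations X := by
  have := hC.regular
  have := h.hasFiniteLimits
  have hst := h.hasStableCoequalizers hC.hasStableCoequalizers
  exact ⟨regular_of_hasStableCoequalizers hst, h.isProtomodular hC', hst⟩

end Reflections

end SemiLoc

namespace SemiLoc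

/-! ### Covering embeddings: reflection and protomodularity. -/

section CoveringEmbedding

variable {X : Type*} [Category X] {D : Type*} [Category D]

/-- A fully faithful left exact functor whose essential image is closed under subobjects and such
that every object of the target is a regular quotient of an object in the image. -/
structure IsCoveringEmbedding (I : X ⥤ D) : Prop where
  full : I.Full
  faithful : I.Faithful
  preservesFiniteLimits : PreservesFiniteLimits I
  essImage_of_mono : ∀ ⦃A : X⦄ ⦃M : D⦄ (m : M ⟶ I.obj A), Mono m → I.essImage M
  exists_cover : ∀ Q : D, ∃ (A : X) (q : I.obj A ⟶ Q), IsRegularEpi q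

/-- To show that a pair is jointly strongly epimorphic, it suffices to show that every
monomorphism through which both members factor is an isomorphism. -/
lemma jointlyStrongEpi_of_isIso [HasFiniteLimits D] {A B E : D} (g : A ⟶ E) (s : B ⟶ E)
    (h : ∀ ⦃M : D⦄ (m : M ⟶ E) (a : A ⟶ M) (b : B ⟶ M), Mono m → a ≫ m = g → b ≫ m = s →
      IsIso m) : JointlyStrongEpi g s where
  hom_ext T a b h₁ h₂ := by
    have := h (equalizer.ι a b) (equalizer.lift g h₁) (equalizer.lift s h₂) inferInstance
      (equalizer.lift_ι _ _) (equalizer.lift_ι _ _)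
    rw [← cancel_epi (equalizer.ι a b), equalizer.condition]
  exists_lift M N m _ a b t h₁ h₂ := by
    have := h (pullback.snd m t) (pullback.lift a g h₁) (pullback.lift b s h₂) inferInstance
      (pullback.lift_snd _ _ _) (pullback.lift_snd _ _ _)
    refine ⟨inv (pullback.snd m t) ≫ pullback.fst m t, ?_, ?_, ?_⟩
    · rw [← pullback.lift_snd (f := m) (g := t) a g h₁, Category.assoc, IsIso.hom_inv_id_assoc,
        pullback.lift_fst]
    · rw [← pullback.lift_snd (f := m) (g := t) b s h₂, Category.assoc, IsIso.hom_inv_id_assoc,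
        pullback.lift_fst]
    · rw [Category.assoc, pullback.condition, IsIso.inv_hom_id_assoc]

namespace IsCoveringEmbedding

variable {I : X ⥤ D} (hI : IsCoveringEmbedding I)

include hI

/-- The pair is a subobject of `I A ⨯ I B`, which is `I (A ⨯ B)`, so closure under subobjects
applies. -/
lemma exists_of_jointly_mono [HasFiniteLimits X] [HasFiniteLimits D] {A B : X} {P : D}
    (a : P ⟶ I.obj A) (b : P ⟶ I.obj B)
    (h : ∀ ⦃W : D⦄ (x y : W ⟶ P), x ≫ a = y ≫ a → x ≫ b = y ≫ b → x = y) :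
    ∃ (R : X) (d : R ⟶ A) (c : R ⟶ B) (e : I.obj R ≅ P),
      e.hom ≫ a = I.map d ∧ e.hom ≫ b = I.map c := by
  have := hI.full
  have := hI.preservesFiniteLimits
  have hm : Mono (prod.lift a b) := ⟨fun x y hxy => h x y
    (by simpa [prod.lift_fst] using congr($hxy ≫ prod.fst)) (by simpa [prod.lift_snd] using congr($hxy ≫ prod.snd))⟩
  obtain ⟨R, ⟨e⟩⟩ := hI.essImage_of_mono
    (prod.lift a b ≫ inv (prodComparison I A B)) inferInstance
  exact ⟨R, I.preimage (e.hom ≫ a), I.preimage (e.hom ≫ b), e, by simp, by simp⟩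

lemma exists_of_mono {A : X} {M : D} (m : M ⟶ I.obj A) [Mono m] :
    ∃ (B : X) (n : B ⟶ A) (e : I.obj B ≅ M), Mono n ∧ e.hom ≫ m = I.map n := by
  have := hI.full
  have := hI.faithful
  obtain ⟨B, ⟨e⟩⟩ := hI.essImage_of_mono m inferInstance
  have : Mono (I.map (I.preimage (e.hom ≫ m))) := by
    rw [I.map_preimage]
    infer_instance
  exact ⟨B, I.preimage (e.hom ≫ m), e, I.mono_of_mono_map this, by simp⟩

/-- The kernel pair is a relation on an object of `X`, so it lies in `X`; reflexivity, symmetry and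
transitivity are preimages of maps induced by its universal property. -/
lemma exists_isKernelPair [HasFiniteLimits X] [HasFiniteLimits D] {A : X} {Q : D}
    (q : I.obj A ⟶ Q) :
    ∃ (R : X) (d c : R ⟶ A), IsKernelPair q (I.map d) (I.map c) ∧ IsEquivalenceRelation d c := by
  have := hI.full
  have := hI.faithful
  obtain ⟨R, d, c, e, hd, hc⟩ := hI.exists_of_jointly_mono (pullback.fst q q) (pullback.snd q q)
    (fun _ _ _ => pullback.hom_ext)
  have hk : IsKernelPair q (I.map d) (I.map c) :=
    (IsKernelPair.of_hasPullback q).of_iso e.symm (Iso.refl _) (Iso.refl _) (Iso.refl _)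
      (by simp [← hd]) (by simp [← hc]) (by simp) (by simp)
  refine ⟨R, d, c, hk, isEquivalenceRelation_of_elements ?_
    (I.preimage (hk.lift (𝟙 _) (𝟙 _) rfl)) ?_ ?_
    (I.preimage (hk.lift (I.map c) (I.map d) hk.w.symm)) ?_ ?_ ?_⟩
  · intro W a b h₁ h₂
    apply I.map_injective
    apply hk.hom_ext <;> simp only [← I.map_comp, h₁, h₂]
  any_goals exact I.map_injective (by simp)
  · intro W a b hab
    have hw : I.map (a ≫ d) ≫ q = I.map (b ≫ c) ≫ q := by
      rw [I.map_comp_assoc, hk.w, ← I.map_comp_assoc, hab, I.map_comp_assoc, hk.w,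
        I.map_comp_assoc]
    exact ⟨I.preimage (hk.lift _ _ hw), I.map_injective (by simp), I.map_injective (by simp)⟩

/-- If a regular category admits a covering embedding of a protomodular category, then it is itself
protomodular. -/
lemma isProtomodular [HasFiniteLimits X] [Regular D] (hX : IsProtomodular X) :
    IsProtomodular D := by
  have := hI.full
  have := hI.faithful
  have := hI.preservesFiniteLimits
  refine ⟨inferInstance, fun P E A B g q p f s sq hs => ?_⟩
  apply jointlyStrongEpi_of_isIso
  intro M m a b _ ha hb
  have : IsSplitMono s := ⟨⟨⟨p, hs⟩⟩⟩
  obtain ⟨E₀, e, _⟩ := hI.exists_cover E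
  -- `B₀` is the part of the cover lying over the section. As `s` is monic it is a subobject of `I
  -- E₀`, so it lies in `X`.
  obtain ⟨B₀, b₀, i, -, hi⟩ := hI.exists_of_mono (pullback.fst e s)
  let β : I.obj B₀ ⟶ B := i.hom ≫ pullback.snd e s
  have hβ : I.map b₀ ≫ e = β ≫ s := by
    rw [← hi, Category.assoc, Category.assoc, pullback.condition]
  have : StrongEpi β := strongEpi_comp _ _
  -- `E₀` itself need not carry a split epimorphism in `X` covering `p`. Its pullback over `B` with
  -- `B₀` does: `p₁`, with section given by `b₀` and the identity.
  obtain ⟨E₁, u, p₁, j, hu, hp₁⟩ := hI.exists_of_jointly_mono (pullback.fst (e ≫ p) β)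
    (pullback.snd (e ≫ p) β) (fun _ _ _ => pullback.hom_ext)
  have sq₁ : IsPullback (I.map u) (I.map p₁) (e ≫ p) β :=
    (IsPullback.of_hasPullback (e ≫ p) β).of_iso j.symm (Iso.refl _) (Iso.refl _) (Iso.refl _)
      (by simp [← hu]) (by simp [← hp₁]) (by simp) (by simp)
  have : IsRegularEpi β := inferInstance
  have : StrongEpi (I.map u) := by
    rw [← hu]
    infer_instance
  let ε : I.obj E₁ ⟶ E := I.map u ≫ e
  have hε : ε ≫ p = I.map p₁ ≫ β := by
    rw [Category.assoc, sq₁.w]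
  have : StrongEpi ε := strongEpi_comp _ _
  obtain ⟨s₁, hs₁⟩ := I.map_surjective (sq₁.lift (I.map b₀) (𝟙 _) (by
    rw [reassoc_of% hβ, hs, Category.id_comp, Category.comp_id]))
  have hs₁u : I.map s₁ ≫ I.map u = I.map b₀ := by rw [hs₁, sq₁.lift_fst]
  have hs₁p : s₁ ≫ p₁ = 𝟙 _ := I.map_injective (by rw [I.map_comp, hs₁, sq₁.lift_snd, I.map_id])
  have hs₁ε : I.map s₁ ≫ ε = β ≫ s := by rw [← hβ, ← hs₁u, Category.assoc]
  -- This pullback need not lie in `X`, so it is covered in turn to obtain a morphism `f₀` of `X`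
  -- lying over `f`.
  obtain ⟨A₀, α', _⟩ := hI.exists_cover (pullback f β)
  obtain ⟨f₀, hf₀⟩ := I.map_surjective (α' ≫ pullback.snd f β)
  have hf : (α' ≫ pullback.fst f β) ≫ f = I.map f₀ ≫ β := by
    rw [hf₀, Category.assoc, Category.assoc, pullback.condition]
  have sq₂ := IsPullback.of_hasPullback p₁ f₀
  have hj := hX.jointlyStrongEpi _ _ _ _ s₁ sq₂ hs₁p
  have hδ : (I.map (pullback.fst p₁ f₀) ≫ ε) ≫ p =
      (I.map (pullback.snd p₁ f₀) ≫ α' ≫ pullback.fst f β) ≫ f := by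
    rw [Category.assoc, hε, Category.assoc, hf, ← I.map_comp_assoc, ← I.map_comp_assoc, sq₂.w]
  -- `N` is the inverse image of `M` in the cover, a subobject in `X` containing both legs.
  -- Protomodularity of `X` gives `n` a section, so the strong epimorphism `ε` factors through `m`.
  obtain ⟨N, n, k, _, hk⟩ := hI.exists_of_mono (pullback.snd m ε)
  have sq₃ : IsPullback (k.hom ≫ pullback.fst m ε) (I.map n) m ε :=
    (IsPullback.of_hasPullback m ε).of_iso k.symm (Iso.refl _) (Iso.refl _) (Iso.refl _)
      (by simp) (by simp [← hk]) (by simp) (by simp)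
  obtain ⟨a₁, ha₁⟩ := I.map_surjective (sq₃.lift (sq.lift _ _ hδ ≫ a)
    (I.map (pullback.fst p₁ f₀)) (by rw [Category.assoc, ha, sq.lift_fst]))
  obtain ⟨b₁, hb₁⟩ := I.map_surjective (sq₃.lift (β ≫ b) (I.map s₁)
    (by rw [Category.assoc, hb, hs₁ε]))
  obtain ⟨l, -, -, hl⟩ := hj.exists_lift n a₁ b₁ (𝟙 _)
    (I.map_injective (by rw [I.map_comp, ha₁, sq₃.lift_snd, Category.comp_id]))
    (I.map_injective (by rw [I.map_comp, hb₁, sq₃.lift_snd, Category.comp_id]))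
  have hfac : (I.map l ≫ k.hom ≫ pullback.fst m ε) ≫ m = ε := by
    rw [Category.assoc, sq₃.w, ← I.map_comp_assoc, hl, I.map_id, Category.id_comp]
  have : StrongEpi ((I.map l ≫ k.hom ≫ pullback.fst m ε) ≫ m) := by rwa [hfac]
  have : StrongEpi m := strongEpi_of_strongEpi (I.map l ≫ k.hom ≫ pullback.fst m ε) m
  exact isIso_of_mono_of_strongEpi m

section Reflection

variable [HasFiniteLimits X] [HasFiniteLimits D]
  (hX : HasStableCoequalizersOfEquivalenceRelations X)

include hX

/-- Maps `Q ⟶ I Z` are maps `A ⟶ Z` coequalizing the kernel pair of a cover `I A ⟶ Q`. That kernel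
pair lies in `X`, so its coequalizer there represents them. -/
lemma exists_universal (Q : D) :
    ∃ (T : X) (η : Q ⟶ I.obj T), ∀ Z : X, Function.Bijective (fun g : T ⟶ Z => η ≫ I.map g) := by
  have := hI.full
  have := hI.faithful
  obtain ⟨A, q, _⟩ := hI.exists_cover Q
  obtain ⟨R, d, c, hk, hdc⟩ := hI.exists_isKernelPair q
  obtain ⟨T, π, w, hπ, -⟩ := hX d c hdc
  obtain ⟨η, hη⟩ := IsRegularEpi.exists_of_isKernelPair q hk (I.map π)
    (by rw [← I.map_comp, w, I.map_comp])
  refine ⟨T, η, fun Z => ⟨fun g h hgh => ?_, fun k => ?_⟩⟩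
  · apply hom_ext_of_isColimit hπ
    apply I.map_injective
    dsimp only at hgh
    rw [I.map_comp, I.map_comp, ← hη, Category.assoc, Category.assoc, hgh]
  · obtain ⟨l, hl⟩ := exists_desc_of_isColimit hπ (I.preimage (q ≫ k))
      (I.map_injective (by simp [reassoc_of% hk.w]))
    refine ⟨l, ?_⟩
    dsimp only
    rw [← cancel_epi q, reassoc_of% hη, ← I.map_comp, hl, I.map_preimage]

lemma isRightAdjoint : I.IsRightAdjoint := by
  choose T η hη using hI.exists_universal hX
  exact (Adjunction.adjunctionOfEquivLeft (G := I)
    (fun Q Z => Equiv.ofBijective _ (hη Q Z)) (by simp)).isRightAdjoint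

end Reflection

/-- The image of `I.map g` is a subobject of `I B`, so it comes from a monomorphism of `X` through
which `g` factors; that monomorphism is invertible. -/
lemma strongEpi_map [HasFiniteLimits X] [Regular D] {A B : X} (g : A ⟶ B) [IsRegularEpi g] :
    StrongEpi (I.map g) := by
  have := hI.full
  have := hI.faithful
  let F := Regular.strongEpiMonoFactorisation (I.map g)
  have : Mono F.m := F.m_mono
  have : StrongEpi F.e := inferInstance
  obtain ⟨B', n, e, _, hn⟩ := hI.exists_of_mono F.m
  obtain ⟨g', hg'⟩ := I.map_surjective (F.e ≫ e.inv)
  have hfac : g' ≫ n = g := I.map_injective (by rw [I.map_comp, hg', ← hn]; simp [F])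
  have : IsIso n := ExtremalEpi.isIso g g' n hfac
  have : IsIso F.m := by
    rw [← e.inv_hom_id_assoc F.m, hn]
    infer_instance
  rw [← F.fac]
  exact strongEpi_comp _ _

/-- A category with finite limits and stable coequalizers of equivalence relations is a
semi-localization, with regular epimorphic unit components, of any regular category in which it
has a covering embedding. -/
lemma isSemiLocalizationWithRegularEpiUnits [HasFiniteLimits X] [Regular D]
    (hX : HasStableCoequalizersOfEquivalenceRelations X) :
    IsSemiLocalizationWithRegularEpiUnits I := by
  have := hI.full
  have := hI.faithful
  have := hI.preservesFiniteLimits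
  have := hI.isRightAdjoint hX
  refine ⟨{ L := I.leftAdjoint, adj := Adjunction.ofIsRightAdjoint I }, ?_⟩
  set adj : I.leftAdjoint ⊣ I := Adjunction.ofIsRightAdjoint I
  change IsSemiLeftExact adj ∧ ∀ Q, IsRegularEpi (adj.unit.app Q)
  -- The abstract adjoint is identified with the concrete construction: `q ≫ η` comes from a
  -- coequalizer `π` in `X` of the kernel pair of the cover `q`.
  have key (Q : D) : ∃ (A R : X) (d c : R ⟶ A) (q : I.obj A ⟶ Q) (π : A ⟶ I.leftAdjoint.obj Q)
      (w : d ≫ π = c ≫ π), IsRegularEpi q ∧ IsEquivalenceRelation d c ∧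
        I.map d ≫ q = I.map c ≫ q ∧ I.map π = q ≫ adj.unit.app Q ∧
        Nonempty (IsColimit (Cofork.ofπ π w)) := by
    obtain ⟨A, q, _⟩ := hI.exists_cover Q
    obtain ⟨R, d, c, hk, hdc⟩ := hI.exists_isKernelPair q
    obtain ⟨π, hπ⟩ := I.map_surjective (q ≫ adj.unit.app Q)
    have w : d ≫ π = c ≫ π := I.map_injective (by simp [hπ, reassoc_of% hk.w])
    have hη := (isIso_map_iff_bijective_precomp adj _).1 (isIso_map_unit_app adj Q)
    refine ⟨A, R, d, c, q, π, w, inferInstance, hdc, hk.w, hπ,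
      nonempty_isColimit_cofork w ?_ ?_⟩
    · intro Z k hk'
      obtain ⟨l, hl⟩ := IsRegularEpi.exists_of_isKernelPair q hk (I.map k)
        (by rw [← I.map_comp, hk', I.map_comp])
      obtain ⟨l', rfl⟩ := (hη Z).2 l
      exact ⟨I.preimage l', I.map_injective (by simpa [hπ] using hl)⟩
    · intro Z a b hab
      apply I.map_injective
      apply (hη Z).1
      dsimp only
      rw [← cancel_epi q, ← Category.assoc, ← Category.assoc, ← hπ, ← I.map_comp, hab, I.map_comp]
  constructor
  · apply isSemiLeftExact_of_isIso
    intro Q P B f a b sq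
    obtain ⟨A, R, d, c, q, π, w, _, hdc, hq, hπ, hcolim⟩ := key Q
    have sqX := IsPullback.of_hasPullback π f
    obtain ⟨S, r, d', c', w', hd', hc', hcolim'⟩ :=
      hX.exists_isColimit_of_isPullback hdc hcolim sqX
    have sqI := sqX.map I
    rw [hπ] at sqI
    obtain ⟨q', hq'₁, hq'₂⟩ : ∃ q', q' ≫ a = I.map (pullback.fst π f) ≫ q ∧
        q' ≫ b = I.map (pullback.snd π f) :=
      ⟨sq.lift _ _ (by rw [Category.assoc, sqI.w]), sq.lift_fst _ _ _, sq.lift_snd _ _ _⟩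
    -- Cancelling in the pasted square shows that `q'` is a pullback of `q`, hence a cover of `P`.
    -- Maps out of `P` can then be compared with maps out of the pulled-back coequalizer in `X`.
    have sq' : IsPullback (I.map (pullback.fst π f)) q' q a :=
      IsPullback.of_bot (by rwa [hq'₂]) hq'₁.symm sq
    have : IsRegularEpi q' :=
      Regular.regularEpiIsStableUnderBaseChange.of_isPullback sq' ‹IsRegularEpi q›
    have hdc' : I.map d' ≫ q' = I.map c' ≫ q' := by
      apply sq.hom_ext
      · rw [Category.assoc, Category.assoc, hq'₁, ← I.map_comp_assoc, ← I.map_comp_assoc, hd', hc',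
          I.map_comp_assoc, I.map_comp_assoc, hq]
      · rw [Category.assoc, Category.assoc, hq'₂, ← I.map_comp, ← I.map_comp, w']
    refine (isIso_map_iff_bijective_precomp adj b).2 fun Z => ⟨fun g h hgh => ?_, fun k => ?_⟩
    · obtain ⟨g, rfl⟩ := I.map_surjective g
      obtain ⟨h, rfl⟩ := I.map_surjective h
      congr 1
      apply hom_ext_of_isColimit hcolim'
      apply I.map_injective
      dsimp only at hgh
      rw [I.map_comp, I.map_comp, ← hq'₂, Category.assoc, Category.assoc, hgh]
    · obtain ⟨l, hl⟩ := exists_desc_of_isColimit hcolim' (I.preimage (q' ≫ k))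
        (I.map_injective (by simp [reassoc_of% hdc']))
      refine ⟨I.map l, ?_⟩
      dsimp only
      rw [← cancel_epi q', reassoc_of% hq'₂, ← I.map_comp, hl, I.map_preimage]
  · intro Q
    obtain ⟨A, R, d, c, q, π, w, _, hdc, hq, hπ, hcolim⟩ := key Q
    have := isRegularEpi_of_isColimit hcolim
    have : StrongEpi (q ≫ adj.unit.app Q) := by
      rw [← hπ]
      exact hI.strongEpi_map π
    have := strongEpi_of_strongEpi q (adj.unit.app Q)
    infer_instance

end IsCoveringEmbedding

end CoveringEmbedding

end SemiLoc

namespace SemiLoc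

/-! ### Generalized elements in the ex/reg completion, and its finite limits. -/

noncomputable section Relations

variable {C : Type u} [Category.{v} C] [Regular C]

namespace Relation

variable {X Y Z : C}

/-- The inverse image of a relation along a pair of morphisms. -/
def pull {X' Y' : C} (f : X' ⟶ X) (g : Y' ⟶ Y) (R : Relation X Y) : Relation X' Y' :=
  (Subobject.pullback (prod.map f g)).obj R

lemma holds_pull {X' Y' : C} {f : X' ⟶ X} {g : Y' ⟶ Y} {R : Relation X Y} {W : C} {x : W ⟶ X'}
    {y : W ⟶ Y'} : (pull f g R).Holds x y ↔ R.Holds (x ≫ f) (y ≫ g) := by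
  have sq := Subobject.isPullback (prod.map f g) R
  have hl : prod.lift x y ≫ prod.map f g = prod.lift (x ≫ f) (y ≫ g) := prod.lift_map _ _ _ _
  unfold Holds pull
  rw [← hl]
  constructor
  · intro h
    rw [← Subobject.factorThru_arrow _ _ h, Category.assoc, ← sq.w, ← Category.assoc]
    exact Subobject.factors_comp_arrow _
  · intro h
    have h' := Subobject.factorThru_arrow _ _ h
    rw [← sq.lift_snd (R.factorThru _ h) (prod.lift x y) h']
    exact Subobject.factors_comp_arrow _

lemma holds_inf {R S : Relation X Y} {W : C} {x : W ⟶ X} {y : W ⟶ Y} :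
    Holds (R ⊓ S) x y ↔ R.Holds x y ∧ S.Holds x y :=
  Subobject.inf_factors _

lemma holds_top {W : C} (x : W ⟶ X) (y : W ⟶ Y) : Holds (⊤ : Relation X Y) x y :=
  Subobject.top_factors _

lemma Holds.comp {R : Relation X Y} {S : Relation Y Z} {W : C} {x : W ⟶ X} {y : W ⟶ Y} {z : W ⟶ Z}
    (h : R.Holds x y) (h' : S.Holds y z) : (comp R S).Holds x z :=
  holds_comp.2 ⟨W, 𝟙 W, inferInstance, y, by simpa using h, by simpa using h'⟩

lemma ext_of_holds {R S : Relation X Y}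
    (h : ∀ ⦃W : C⦄ (x : W ⟶ X) (y : W ⟶ Y), R.Holds x y ↔ S.Holds x y) : R = S :=
  le_antisymm (le_iff.2 fun _ x y => (h x y).1) (le_iff.2 fun _ x y => (h x y).2)

lemma isEquiv_of_holds {R : Relation X X} (hr : ∀ ⦃W : C⦄ (x : W ⟶ X), R.Holds x x)
    (hs : ∀ ⦃W : C⦄ (x y : W ⟶ X), R.Holds x y → R.Holds y x)
    (ht : ∀ ⦃W : C⦄ (x y z : W ⟶ X), R.Holds x y → R.Holds y z → R.Holds x z) : R.IsEquiv where
  refl := le_iff.2 fun W x y h => by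
    rw [holds_graph, Category.comp_id] at h
    exact h ▸ hr x
  symm := le_iff.2 fun W x y h => holds_op.2 (hs x y h)
  trans := le_iff.2 fun W x z h => by
    obtain ⟨W', e, _, y, h₁, h₂⟩ := holds_comp.1 h
    exact holds_of_cover e (ht _ _ _ h₁ h₂)

end Relation

namespace ExReg

open SemiLoc.Relation

variable {A B D : ExReg C} {W : C}

lemma rel_refl (A : ExReg C) (x : W ⟶ A.carrier) : A.rel.Holds x x :=
  le_iff.1 A.isEquiv.refl _ _ (holds_graph.2 (Category.comp_id x))

lemma rel_of_eq {x y : W ⟶ A.carrier} (h : x = y) : A.rel.Holds x y :=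
  h ▸ A.rel_refl x

lemma rel_symm {x y : W ⟶ A.carrier} (h : A.rel.Holds x y) : A.rel.Holds y x :=
  holds_op.1 (le_iff.1 A.isEquiv.symm _ _ h)

lemma rel_trans {x y z : W ⟶ A.carrier} (h : A.rel.Holds x y) (h' : A.rel.Holds y z) :
    A.rel.Holds x z :=
  le_iff.1 A.isEquiv.trans _ _ (h.comp h')

/-- A morphism `f : A ⟶ B` sends the class of the generalized element `x` to that of `y`. -/
def Maps (f : A ⟶ B) (x : W ⟶ A.carrier) (y : W ⟶ B.carrier) : Prop :=
  (Hom.rel f).Holds x y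

lemma Maps.source {f : A ⟶ B} {x x' : W ⟶ A.carrier} {y : W ⟶ B.carrier} (h : Maps f x' y)
    (hx : A.rel.Holds x x') : Maps f x y := by
  have := hx.comp h
  rwa [Hom.source_comp] at this

lemma Maps.target {f : A ⟶ B} {x : W ⟶ A.carrier} {y y' : W ⟶ B.carrier} (h : Maps f x y)
    (hy : B.rel.Holds y y') : Maps f x y' := by
  have := Holds.comp h hy
  rwa [Hom.comp_target] at this

lemma Maps.precomp {f : A ⟶ B} {x : W ⟶ A.carrier} {y : W ⟶ B.carrier} (h : Maps f x y)
    {W' : C} (e : W' ⟶ W) : Maps f (e ≫ x) (e ≫ y) :=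
  Holds.precomp h e

lemma Maps.of_cover {f : A ⟶ B} {x : W ⟶ A.carrier} {y : W ⟶ B.carrier} {W' : C} (e : W' ⟶ W)
    [StrongEpi e] (h : Maps f (e ≫ x) (e ≫ y)) : Maps f x y :=
  holds_of_cover e h

lemma exists_maps (f : A ⟶ B) (x : W ⟶ A.carrier) :
    ∃ (W' : C) (e : W' ⟶ W) (_ : StrongEpi e) (y : W' ⟶ B.carrier), Maps f (e ≫ x) y := by
  obtain ⟨W', e, he, y, h, -⟩ := holds_comp.1 (le_iff.1 (Hom.total f) _ _ (A.rel_refl x))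
  exact ⟨W', e, he, y, h⟩

lemma Maps.unique {f : A ⟶ B} {x : W ⟶ A.carrier} {y y' : W ⟶ B.carrier} (h : Maps f x y)
    (h' : Maps f x y') : B.rel.Holds y y' :=
  le_iff.1 (Hom.singleValued f) _ _ (Holds.comp (holds_op.2 h) h')

lemma maps_comp {f : A ⟶ B} {g : B ⟶ D} {x : W ⟶ A.carrier} {z : W ⟶ D.carrier} :
    Maps (f ≫ g) x z ↔ ∃ (W' : C) (e : W' ⟶ W) (_ : StrongEpi e) (y : W' ⟶ B.carrier),
      Maps f (e ≫ x) y ∧ Maps g y (e ≫ z) :=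
  holds_comp

lemma Maps.comp {f : A ⟶ B} {g : B ⟶ D} {x : W ⟶ A.carrier} {y : W ⟶ B.carrier}
    {z : W ⟶ D.carrier} (h : Maps f x y) (h' : Maps g y z) : Maps (f ≫ g) x z :=
  Holds.comp h h'

/-- One inclusion suffices: `f` is total and `g` is single-valued, so any value of `g` is locally
equivalent to a value of `f`. -/
lemma hom_ext_of_maps {f g : A ⟶ B}
    (h : ∀ ⦃W : C⦄ (x : W ⟶ A.carrier) (y : W ⟶ B.carrier), Maps f x y → Maps g x y) : f = g := by
  refine Hom.ext (ext_of_holds fun W x y => ⟨h x y, fun (hg : Maps g x y) => ?_⟩)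
  obtain ⟨W', e, _, y', hf⟩ := exists_maps f x
  exact holds_of_cover e (hf.target ((h _ _ hf).unique (hg.precomp e)))

/-- A morphism given by a relation that is compatible with the equivalence relations, total and
single-valued on generalized elements. -/
def homOfHolds (F : Relation A.carrier B.carrier)
    (hs : ∀ ⦃W : C⦄ (x x' : W ⟶ A.carrier) (y : W ⟶ B.carrier), A.rel.Holds x x' →
      F.Holds x' y → F.Holds x y)
    (ht : ∀ ⦃W : C⦄ (x : W ⟶ A.carrier) (y y' : W ⟶ B.carrier), F.Holds x y →
      B.rel.Holds y y' → F.Holds x y')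
    (htot : ∀ ⦃W : C⦄ (x : W ⟶ A.carrier), ∃ (W' : C) (e : W' ⟶ W) (_ : StrongEpi e)
      (y : W' ⟶ B.carrier), F.Holds (e ≫ x) y)
    (hsv : ∀ ⦃W : C⦄ (x : W ⟶ A.carrier) (y y' : W ⟶ B.carrier), F.Holds x y → F.Holds x y' →
      B.rel.Holds y y') : A ⟶ B :=
  Hom.mk F
    (ext_of_holds fun W x y => ⟨fun h => by
      obtain ⟨W', e, _, x', h₁, h₂⟩ := holds_comp.1 h
      exact holds_of_cover e (hs _ _ _ h₁ h₂), fun h => (A.rel_refl x).comp h⟩)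
    (ext_of_holds fun W x y => ⟨fun h => by
      obtain ⟨W', e, _, x', h₁, h₂⟩ := holds_comp.1 h
      exact holds_of_cover e (ht _ _ _ h₁ h₂), fun h => h.comp (B.rel_refl y)⟩)
    (le_iff.2 fun W x x' h => by
      obtain ⟨W', e, _, y, hy⟩ := htot x'
      exact holds_of_cover e ((hs _ _ _ (h.precomp e) hy).comp (holds_op.2 hy)))
    (le_iff.2 fun W y y' h => by
      obtain ⟨W', e, _, x, h₁, h₂⟩ := holds_comp.1 h
      exact holds_of_cover e (hsv _ _ _ (holds_op.1 h₁) h₂))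

section Elements

lemma rel_embedding_obj {X : C} {x y : W ⟶ X} :
    ((embedding C).obj X).rel.Holds x y ↔ x = y := by
  change (graph (𝟙 X)).Holds x y ↔ x = y
  rw [holds_graph, Category.comp_id]

lemma maps_embedding_map {X Y : C} {f : X ⟶ Y} {x : W ⟶ X} {y : W ⟶ Y} :
    Maps ((embedding C).map f) x y ↔ x ≫ f = y :=
  holds_graph

/-- A generalized element of the carrier of `A`, as a morphism into `A`. -/
def elt (A : ExReg C) (x : W ⟶ A.carrier) : (embedding C).obj W ⟶ A :=
  have h : ∀ {V : C} {w : V ⟶ W} {y : V ⟶ A.carrier},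
      (pull x (𝟙 A.carrier) A.rel).Holds w y ↔ A.rel.Holds (w ≫ x) y := by
    intro V w y
    rw [holds_pull, Category.comp_id]
  homOfHolds (A := (embedding C).obj W) (pull x (𝟙 A.carrier) A.rel)
    (fun _ _ _ _ hw hy => rel_embedding_obj.1 hw ▸ hy)
    (fun _ _ _ _ hy hy' => h.2 (rel_trans (h.1 hy) hy'))
    (fun V (w : V ⟶ W) => ⟨V, 𝟙 V, inferInstance, w ≫ x, h.2 (rel_of_eq
      (congrArg (fun t : V ⟶ W => t ≫ x) (Category.id_comp w)))⟩)
    (fun _ _ _ _ hy hy' => rel_trans (rel_symm (h.1 hy)) (h.1 hy'))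

lemma maps_elt {x : W ⟶ A.carrier} {V : C} {w : V ⟶ W} {y : V ⟶ A.carrier} :
    Maps (A.elt x) w y ↔ A.rel.Holds (w ≫ x) y := by
  change (pull x (𝟙 A.carrier) A.rel).Holds w y ↔ _
  rw [holds_pull, Category.comp_id]

lemma maps_elt_id {x y : W ⟶ A.carrier} :
    Maps (A.elt x) (𝟙 W) y ↔ A.rel.Holds x y :=
  maps_elt.trans (by rw [Category.id_comp])

lemma elt_eq_iff {x y : W ⟶ A.carrier} : A.elt x = A.elt y ↔ A.rel.Holds x y := by
  constructor
  · intro h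
    have h' : Maps (A.elt x) (𝟙 W) y := h ▸ maps_elt_id.2 (A.rel_refl y)
    exact maps_elt_id.1 h'
  · intro h
    exact hom_ext_of_maps fun V (w : V ⟶ W) z hz =>
      maps_elt.2 (rel_trans (rel_symm (h.precomp w)) (maps_elt.1 hz))

lemma map_comp_elt {V : C} (e : V ⟶ W) (x : W ⟶ A.carrier) :
    (embedding C).map e ≫ A.elt x = A.elt (e ≫ x) := by
  symm
  exact hom_ext_of_maps fun U (w : U ⟶ V) z hz =>
    Maps.comp (B := (embedding C).obj W) (y := w ≫ e) (maps_embedding_map.2 rfl)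
      (maps_elt.2 (rel_trans (rel_of_eq (Category.assoc w e x)) (maps_elt.1 hz)))

/-- The dictionary between equations of arrows and statements about elements; evaluation at the
identity of `W` gives the forward direction. -/
lemma elt_comp_eq_iff {f : A ⟶ B} {x : W ⟶ A.carrier} {y : W ⟶ B.carrier} :
    A.elt x ≫ f = B.elt y ↔ Maps f x y := by
  constructor
  · intro h
    have h' : Maps (A.elt x ≫ f) (𝟙 W) y := h ▸ maps_elt_id.2 (B.rel_refl y)
    obtain ⟨W', e, _, x', h₁, h₂⟩ := maps_comp.1 h'
    have h₃ := maps_elt.1 h₁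
    have h₄ : (e ≫ 𝟙 W) ≫ x = e ≫ x := by rw [Category.comp_id]
    exact Maps.of_cover e (h₂.source (h₄ ▸ h₃))
  · intro h
    symm
    exact hom_ext_of_maps fun V (w : V ⟶ W) z hz =>
      Maps.comp (maps_elt.2 (A.rel_refl _)) ((h.precomp w).target (maps_elt.1 hz))

/-- Totality at the generic element `𝟙 W` yields a representing element only after passing to a
cover. -/
lemma exists_elt (l : (embedding C).obj W ⟶ A) :
    ∃ (W' : C) (e : W' ⟶ W) (_ : StrongEpi e) (x : W' ⟶ A.carrier),
      (embedding C).map e ≫ l = A.elt x := by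
  obtain ⟨W', e, he, x, h⟩ := exists_maps l (𝟙 W)
  have h₁ : e ≫ 𝟙 W = e := Category.comp_id e
  have h₂ : Maps l e x := h₁ ▸ h
  refine ⟨W', e, he, x, ?_⟩
  symm
  exact hom_ext_of_maps fun V (w : V ⟶ W') z hz =>
    Maps.comp (B := (embedding C).obj W) (y := w ≫ e) (maps_embedding_map.2 rfl)
      ((h₂.precomp w).target (maps_elt.1 hz))

lemma embedding_elt {X : C} (x : W ⟶ X) :
    ((embedding C).obj X).elt x = (embedding C).map x :=
  hom_ext_of_maps fun _ _ _ hz => maps_embedding_map.2 (rel_embedding_obj.1 (maps_elt.1 hz))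

end Elements

section Pullbacks

variable {P Z : ExReg C}

lemma hom_ext_of_jointly_injective {T : ExReg C} {p : P ⟶ A} {q : P ⟶ B}
    (h : ∀ ⦃W : C⦄ (t t' : W ⟶ P.carrier) (x : W ⟶ A.carrier) (y : W ⟶ B.carrier), Maps p t x →
      Maps p t' x → Maps q t y → Maps q t' y → P.rel.Holds t t')
    {m m' : T ⟶ P} (h₁ : m ≫ p = m' ≫ p) (h₂ : m ≫ q = m' ≫ q) : m = m' := by
  apply hom_ext_of_maps
  intro W t s hs
  obtain ⟨W₁, e₁, _, s', hs'⟩ := exists_maps m' t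
  obtain ⟨W₂, e₂, _, x, hx⟩ := exists_maps p (e₁ ≫ s)
  obtain ⟨W₃, e₃, _, y, hy⟩ := exists_maps q (e₂ ≫ e₁ ≫ s)
  have hm : ∀ {E : ExReg C} (r : P ⟶ E), m ≫ r = m' ≫ r → ∀ {z : W₃ ⟶ E.carrier},
      Maps r (e₃ ≫ e₂ ≫ e₁ ≫ s) z → Maps r (e₃ ≫ e₂ ≫ s') z := by
    intro E r hr z hz
    have hz' := ((((hs.precomp e₁).precomp e₂).precomp e₃).comp hz)
    rw [hr] at hz'
    obtain ⟨W₄, e₄, _, s'', h₁, h₂⟩ := maps_comp.1 hz'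
    exact Maps.of_cover e₄ (h₂.source ((((hs'.precomp e₂).precomp e₃).precomp e₄).unique h₁))
  have hss := h _ _ _ _ (hx.precomp e₃) (hm p h₁ (hx.precomp e₃)) hy (hm q h₂ hy)
  refine Maps.of_cover e₁ (Maps.of_cover e₂ (Maps.of_cover e₃ ?_))
  exact ((hs'.precomp e₂).precomp e₃).target (rel_symm hss)

/-- Joint injectivity gives uniqueness. The local existence of elements over compatible pairs makes
the mediating relation total. -/
lemma isPullback_of_maps {p : P ⟶ A} {q : P ⟶ B} {f : A ⟶ Z} {g : B ⟶ Z} (w : p ≫ f = q ≫ g)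
    (h : ∀ ⦃W : C⦄ (t t' : W ⟶ P.carrier) (x : W ⟶ A.carrier) (y : W ⟶ B.carrier), Maps p t x →
      Maps p t' x → Maps q t y → Maps q t' y → P.rel.Holds t t')
    (hex : ∀ ⦃W : C⦄ (x : W ⟶ A.carrier) (y : W ⟶ B.carrier) (z : W ⟶ Z.carrier), Maps f x z →
      Maps g y z → ∃ (W' : C) (e : W' ⟶ W) (_ : StrongEpi e) (t : W' ⟶ P.carrier),
        Maps p t (e ≫ x) ∧ Maps q t (e ≫ y)) : IsPullback p q f g := by
  have hlift : ∀ {T : ExReg C} (a : T ⟶ A) (b : T ⟶ B), a ≫ f = b ≫ g →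
      ∃ l : T ⟶ P, l ≫ p = a ∧ l ≫ q = b := by
    intro T a b hab
    -- The mediating map relates `t` to `s` when `a t = p s` and `b t = q s`.
    let l : T ⟶ P := homOfHolds
      (Relation.comp (Hom.rel a) (Relation.op (Hom.rel p)) ⊓
        Relation.comp (Hom.rel b) (Relation.op (Hom.rel q))) ?_ ?_ ?_ ?_
    have hl₁ : ∀ {W : C} {t : W ⟶ T.carrier} {s : W ⟶ P.carrier} {x : W ⟶ A.carrier},
        Maps l t s → Maps p s x → Maps a t x := by
      intro W t s x ht hx
      obtain ⟨W', e, _, x', h₁, h₂⟩ := holds_comp.1 (holds_inf.1 ht).1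
      exact Maps.of_cover e (Maps.target h₁ (Maps.unique (holds_op.1 h₂) (hx.precomp e)))
    have hl₂ : ∀ {W : C} {t : W ⟶ T.carrier} {s : W ⟶ P.carrier} {y : W ⟶ B.carrier},
        Maps l t s → Maps q s y → Maps b t y := by
      intro W t s x ht hx
      obtain ⟨W', e, _, x', h₁, h₂⟩ := holds_comp.1 (holds_inf.1 ht).2
      exact Maps.of_cover e (Maps.target h₁ (Maps.unique (holds_op.1 h₂) (hx.precomp e)))
    refine ⟨l, ?_, ?_⟩
    · apply hom_ext_of_maps
      intro W t x ht
      obtain ⟨W', e, _, s, h₁, h₂⟩ := maps_comp.1 ht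
      exact Maps.of_cover e (hl₁ h₁ h₂)
    · apply hom_ext_of_maps
      intro W t x ht
      obtain ⟨W', e, _, s, h₁, h₂⟩ := maps_comp.1 ht
      exact Maps.of_cover e (hl₂ h₁ h₂)
    · intro W t t' s htt' hs
      rw [holds_inf] at hs ⊢
      constructor
      · obtain ⟨W', e, _, x, h₁, h₂⟩ := holds_comp.1 hs.1
        exact holds_of_cover e (Holds.comp (Maps.source (f := a) h₁ (htt'.precomp e)) h₂)
      · obtain ⟨W', e, _, x, h₁, h₂⟩ := holds_comp.1 hs.2
        exact holds_of_cover e (Holds.comp (Maps.source (f := b) h₁ (htt'.precomp e)) h₂)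
    · intro W t s s' hs hss'
      rw [holds_inf] at hs ⊢
      constructor
      · obtain ⟨W', e, _, x, h₁, h₂⟩ := holds_comp.1 hs.1
        exact holds_of_cover e (Holds.comp h₁ (holds_op.2
          (Maps.source (f := p) (holds_op.1 h₂) (rel_symm (hss'.precomp e)))))
      · obtain ⟨W', e, _, x, h₁, h₂⟩ := holds_comp.1 hs.2
        exact holds_of_cover e (Holds.comp h₁ (holds_op.2
          (Maps.source (f := q) (holds_op.1 h₂) (rel_symm (hss'.precomp e)))))
    · intro W t
      obtain ⟨W₁, e₁, _, x, hx⟩ := exists_maps a t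
      obtain ⟨W₂, e₂, _, z, hz⟩ := exists_maps f x
      have htz := (hx.precomp e₂).comp hz
      rw [hab] at htz
      obtain ⟨W₃, e₃, _, y, hy, hyz⟩ := maps_comp.1 htz
      obtain ⟨W₄, e₄, _, s, hs₁, hs₂⟩ := hex _ _ _ (hz.precomp e₃) hyz
      refine ⟨W₄, e₄ ≫ e₃ ≫ e₂ ≫ e₁, inferInstance, s, ?_⟩
      simp only [Category.assoc]
      exact holds_inf.2 ⟨Holds.comp (((hx.precomp e₂).precomp e₃).precomp e₄) (holds_op.2 hs₁),
        Holds.comp (hy.precomp e₄) (holds_op.2 hs₂)⟩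
    · intro W t s s' hs hs'
      rw [holds_inf] at hs hs'
      obtain ⟨W₁, e₁, _, x, h₁, h₂⟩ := holds_comp.1 hs.1
      obtain ⟨W₂, e₂, _, x', h₁', h₂'⟩ := holds_comp.1 (hs'.1.precomp e₁)
      obtain ⟨W₃, e₃, _, y, h₃, h₄⟩ := holds_comp.1 ((hs.2.precomp e₁).precomp e₂)
      obtain ⟨W₄, e₄, _, y', h₃', h₄'⟩ := holds_comp.1
        (((hs'.2.precomp e₁).precomp e₂).precomp e₃)
      refine holds_of_cover e₁ (holds_of_cover e₂ (holds_of_cover e₃ (holds_of_cover e₄ ?_)))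
      have hxx' := ((Maps.unique (f := a) h₁' (h₁.precomp e₂)).precomp e₃).precomp e₄
      have hyy' := Maps.unique (f := b) h₃' (h₃.precomp e₄)
      exact h _ _ _ _ ((((holds_op.1 h₂).precomp e₂).precomp e₃).precomp e₄)
        (Maps.target (((holds_op.1 h₂').precomp e₃).precomp e₄) hxx')
        ((holds_op.1 h₄).precomp e₄) (Maps.target (holds_op.1 h₄') hyy')
  refine ⟨⟨w⟩, ⟨PullbackCone.isLimitAux' _ fun s => ?_⟩⟩
  have hs := hlift s.fst s.snd s.condition
  exact ⟨hs.choose, hs.choose_spec.1, hs.choose_spec.2, fun {m} h₁ h₂ =>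
    hom_ext_of_jointly_injective h (h₁.trans hs.choose_spec.1.symm)
      (h₂.trans hs.choose_spec.2.symm)⟩

/-- The carrier is the relation of pairs with the same image in `Z`, with equivalence taken
componentwise. -/
lemma exists_isPullback (f : A ⟶ Z) (g : B ⟶ Z) :
    ∃ (P : ExReg C) (p : P ⟶ A) (q : P ⟶ B), IsPullback p q f g := by
  let K : Relation A.carrier B.carrier := Relation.comp (Hom.rel f) (Relation.op (Hom.rel g))
  let π₁ : (K : C) ⟶ A.carrier := K.arrow ≫ prod.fst
  let π₂ : (K : C) ⟶ B.carrier := K.arrow ≫ prod.snd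
  have hP : ∀ {W : C} {t t' : W ⟶ (K : C)}, Holds (pull π₁ π₁ A.rel ⊓ pull π₂ π₂ B.rel) t t' ↔
      A.rel.Holds (t ≫ π₁) (t' ≫ π₁) ∧ B.rel.Holds (t ≫ π₂) (t' ≫ π₂) := by
    intro W t t'
    rw [holds_inf, holds_pull, holds_pull]
  let P : ExReg C := ⟨(K : C), pull π₁ π₁ A.rel ⊓ pull π₂ π₂ B.rel, isEquiv_of_holds
    (fun W t => hP.2 ⟨A.rel_refl _, B.rel_refl _⟩)
    (fun W t t' h => hP.2 ⟨rel_symm (hP.1 h).1, rel_symm (hP.1 h).2⟩)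
    (fun W t t' t'' h h' => hP.2 ⟨rel_trans (hP.1 h).1 (hP.1 h').1,
      rel_trans (hP.1 h).2 (hP.1 h').2⟩)⟩
  have proj : ∀ (E : ExReg C) (π : (K : C) ⟶ E.carrier),
      (∀ {W : C} {t t' : W ⟶ (K : C)}, P.rel.Holds t t' → E.rel.Holds (t ≫ π) (t' ≫ π)) →
      ∃ p : P ⟶ E, ∀ {W : C} {t : W ⟶ (K : C)} {x : W ⟶ E.carrier},
        Maps p t x ↔ E.rel.Holds (t ≫ π) x := by
    intro E π hπ
    have h : ∀ {W : C} {t : W ⟶ (K : C)} {x : W ⟶ E.carrier},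
        Holds (pull π (𝟙 _) E.rel) t x ↔ E.rel.Holds (t ≫ π) x := by
      intro W t x
      rw [holds_pull, Category.comp_id]
    refine ⟨homOfHolds (pull π (𝟙 _) E.rel) ?_ ?_ ?_ ?_, h⟩
    · intro W t t' x htt' hx
      exact h.2 (rel_trans (hπ htt') (h.1 hx))
    · intro W t x x' hx hxx'
      exact h.2 (rel_trans (h.1 hx) hxx')
    · exact fun W t => ⟨W, 𝟙 W, inferInstance, t ≫ π, h.2 (by simpa using E.rel_refl _)⟩
    · intro W t x x' hx hx'
      exact rel_trans (rel_symm (h.1 hx)) (h.1 hx')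
  obtain ⟨p, hp⟩ := proj A π₁ (fun h => (hP.1 h).1)
  obtain ⟨q, hq⟩ := proj B π₂ (fun h => (hP.1 h).2)
  refine ⟨P, p, q, isPullback_of_maps ?_ ?_ ?_⟩
  · apply hom_ext_of_maps
    intro W t z h
    obtain ⟨W', e, _, x, h₁, h₂⟩ := maps_comp.1 h
    have hK : K.Holds (e ≫ t ≫ π₁) (e ≫ t ≫ π₂) :=
      holds_iff.2 ⟨e ≫ t, by simp [π₁], by simp [π₂]⟩
    obtain ⟨W'', e', _, z', h₃, h₄⟩ := holds_comp.1 hK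
    have hx := (hp.1 h₁).precomp e'
    simp only [Category.assoc] at hx
    have hz := Maps.unique h₃ ((h₂.precomp e').source hx)
    refine Maps.of_cover e (Maps.of_cover e' (Maps.comp (y := e' ≫ e ≫ t ≫ π₂) (hq.2 ?_) ?_))
    · simpa only [Category.assoc] using B.rel_refl _
    · exact Maps.target (holds_op.1 h₄) hz
  · intro W t t' x y h₁ h₂ h₃ h₄
    exact hP.2 ⟨rel_trans (hp.1 h₁) (rel_symm (hp.1 h₂)),
      rel_trans (hq.1 h₃) (rel_symm (hq.1 h₄))⟩
  · intro W x y z hx hy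
    obtain ⟨t, rfl, rfl⟩ := holds_iff.1 (Holds.comp hx (holds_op.2 hy) : K.Holds x y)
    exact ⟨W, 𝟙 W, inferInstance, t, hp.2 (by simpa [π₁] using A.rel_refl _),
      hq.2 (by simpa [π₂] using B.rel_refl _)⟩

instance : HasPullbacks (ExReg C) :=
  have : ∀ {A B Z : ExReg C} {f : A ⟶ Z} {g : B ⟶ Z}, HasLimit (cospan f g) := by
    intro A B Z f g
    obtain ⟨P, p, q, h⟩ := exists_isPullback f g
    exact h.hasPullback
  hasPullbacks_of_hasLimit_cospan _

/-- The embedding of the terminal object is terminal. -/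
def isTerminalEmbeddingTerminal : IsTerminal ((embedding C).obj (⊤_ C)) :=
  IsTerminal.ofUniqueHom
    (fun A => homOfHolds (⊤ : Relation A.carrier (⊤_ C)) (fun _ _ _ _ _ _ => holds_top _ _)
      (fun _ _ _ _ _ _ => holds_top _ _)
      (fun W _ => ⟨W, 𝟙 W, inferInstance, terminal.from W, holds_top _ _⟩)
      (fun _ _ _ _ _ _ => rel_embedding_obj.2 (terminal.hom_ext _ _)))
    (fun _ _ => hom_ext_of_maps fun _ _ _ _ => holds_top _ _)

instance : HasTerminal (ExReg C) :=
  isTerminalEmbeddingTerminal.hasTerminal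

instance : HasFiniteLimits (ExReg C) :=
  hasFiniteLimits_of_hasTerminal_and_pullbacks

end Pullbacks

end ExReg

end Relations

end SemiLoc

namespace SemiLoc

/-! ### Exactness of the completion, and the covering embedding. -/

noncomputable section ExactCompletion

variable {C : Type u} [Category.{v} C] [Regular C]

namespace ExReg

open SemiLoc.Relation

variable {A B D : ExReg C} {W : C}

section Surjections

/-- A morphism is surjective if every generalized element of the codomain locally has a
preimage. -/
def Surjective (f : A ⟶ B) : Prop :=
  ∀ ⦃W : C⦄ (y : W ⟶ B.carrier), ∃ (W' : C) (e : W' ⟶ W) (_ : StrongEpi e)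
    (x : W' ⟶ A.carrier), Maps f x (e ≫ y)

/-- A morphism is injective if it is injective on generalized elements, up to the given
equivalence relations. -/
def Injective (f : A ⟶ B) : Prop :=
  ∀ ⦃W : C⦄ (x x' : W ⟶ A.carrier) (y : W ⟶ B.carrier), Maps f x y → Maps f x' y →
    A.rel.Holds x x'

lemma Injective.mono {f : A ⟶ B} (hf : Injective f) : Mono f :=
  ⟨fun _ _ h => hom_ext_of_jointly_injective (p := f) (q := f)
    (fun _ _ _ _ _ h₁ h₂ _ _ => hf _ _ _ h₁ h₂) h h⟩

lemma injective_of_mono (f : A ⟶ B) [Mono f] : Injective f := by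
  intro W x x' y h h'
  rw [← elt_eq_iff, ← cancel_mono f, elt_comp_eq_iff.2 h, elt_comp_eq_iff.2 h']

lemma Surjective.epi {f : A ⟶ B} (hf : Surjective f) : Epi f := by
  refine ⟨fun g h hgh => hom_ext_of_maps fun W y z hz => ?_⟩
  obtain ⟨W', e, _, x, hx⟩ := hf y
  have hxz : Maps (f ≫ h) x (e ≫ z) := hgh ▸ hx.comp (hz.precomp e)
  obtain ⟨W'', e', _, y', h₁, h₂⟩ := maps_comp.1 hxz
  exact Maps.of_cover e (Maps.of_cover e' (h₂.source ((hx.precomp e').unique h₁)))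

/-- A map `k` coequalizing the kernel pair of `f` factors through `f` by the composite of the
opposite of `f` with `k`: surjectivity makes this total, and `hwd` makes it single-valued. -/
lemma Surjective.isRegularEpi {f : A ⟶ B} (hf : Surjective f) : IsRegularEpi f := by
  have := hf.epi
  refine isRegularEpi_of_isColimit (nonempty_isColimit_cofork
    (pullback.condition (f := f) (g := f)) ?_ (fun Z a b => (cancel_epi f).1))
  intro Z k hk
  have hwd : ∀ {W : C} {x x' : W ⟶ A.carrier} {y : W ⟶ B.carrier} {z : W ⟶ Z.carrier},
      Maps f x y → Maps f x' y → Maps k x z → Maps k x' z := by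
    intro W x x' y z hx hx' hz
    rw [← elt_comp_eq_iff] at hx hx' hz ⊢
    have hw : A.elt x ≫ f = A.elt x' ≫ f := hx.trans hx'.symm
    rw [← hz, ← pullback.lift_fst _ _ hw, Category.assoc, hk, pullback.lift_snd_assoc]
  have hF : ∀ {W : C} {y : W ⟶ B.carrier} {z : W ⟶ Z.carrier},
      (Relation.comp (Relation.op (Hom.rel f)) (Hom.rel k)).Holds y z ↔
        ∃ (W' : C) (e : W' ⟶ W) (_ : StrongEpi e) (x : W' ⟶ A.carrier),
          Maps f x (e ≫ y) ∧ Maps k x (e ≫ z) := by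
    intro W y z
    simp only [holds_comp, holds_op]
    rfl
  refine ⟨homOfHolds (Relation.comp (Relation.op (Hom.rel f)) (Hom.rel k)) ?_ ?_ ?_ ?_, ?_⟩
  · intro W y y' z hy h
    obtain ⟨W', e, he, x, h₁, h₂⟩ := hF.1 h
    exact hF.2 ⟨W', e, he, x, h₁.target (rel_symm (hy.precomp e)), h₂⟩
  · intro W y z z' h hz
    obtain ⟨W', e, he, x, h₁, h₂⟩ := hF.1 h
    exact hF.2 ⟨W', e, he, x, h₁, h₂.target (hz.precomp e)⟩
  · intro W y
    obtain ⟨W', e, he, x, hx⟩ := hf y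
    obtain ⟨W'', e', he', z, hz⟩ := exists_maps k x
    refine ⟨W'', e' ≫ e, inferInstance, z, hF.2 ⟨W'', 𝟙 _, inferInstance, e' ≫ x, ?_, ?_⟩⟩
    · simpa using hx.precomp e'
    · simpa using hz
  · intro W y z z' h h'
    obtain ⟨W₁, e₁, _, x, h₁, h₂⟩ := hF.1 h
    obtain ⟨W₂, e₂, _, x', h₁', h₂'⟩ := hF.1 (h'.precomp e₁)
    exact holds_of_cover e₁ (holds_of_cover e₂
      ((hwd (h₁.precomp e₂) h₁' (h₂.precomp e₂)).unique h₂'))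
  · symm
    apply hom_ext_of_maps
    intro W x z hz
    obtain ⟨W', e, he, y, hy⟩ := exists_maps f x
    exact Maps.of_cover e (hy.comp (hF.2 ⟨W', 𝟙 _, inferInstance, e ≫ x, by simpa using hy,
      by simpa using hz.precomp e⟩))

/-- The quotient of `A` by a coarser equivalence relation. -/
lemma exists_quotient (A : ExReg C) (R : Relation A.carrier A.carrier) (hR : R.IsEquiv)
    (hle : A.rel ≤ R) :
    ∃ q : A ⟶ ⟨A.carrier, R, hR⟩, Surjective q ∧
      ∀ ⦃W : C⦄ (x y : W ⟶ A.carrier), Maps q x y ↔ R.Holds x y := by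
  let Q : ExReg C := ⟨A.carrier, R, hR⟩
  refine ⟨homOfHolds (A := A) (B := Q) R ?_ ?_ ?_ ?_, ?_, fun _ _ _ => Iff.rfl⟩
  · intro W x x' y hx h
    exact rel_trans (A := Q) (le_iff.1 hle _ _ hx) h
  · intro W x y y' h hy
    exact rel_trans (A := Q) h hy
  · exact fun W x => ⟨W, 𝟙 W, inferInstance, 𝟙 W ≫ x, Q.rel_refl _⟩
  · intro W x y y' h h'
    exact rel_trans (A := Q) (rel_symm (A := Q) h) h'
  · exact fun W y => ⟨W, 𝟙 W, inferInstance, 𝟙 W ≫ y, Q.rel_refl _⟩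

/-- Every morphism factors as a surjection followed by an injection with the same underlying
relation. -/
lemma exists_image_factorisation (f : A ⟶ B) :
    ∃ (R : Relation A.carrier A.carrier) (hR : R.IsEquiv) (e : A ⟶ ⟨A.carrier, R, hR⟩)
      (m : (⟨A.carrier, R, hR⟩ : ExReg C) ⟶ B), Surjective e ∧ Injective m ∧ e ≫ m = f ∧
        ∀ ⦃W : C⦄ (x : W ⟶ A.carrier) (y : W ⟶ B.carrier), Maps m x y ↔ Maps f x y := by
  let R : Relation A.carrier A.carrier := Relation.comp (Hom.rel f) (Relation.op (Hom.rel f))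
  have hR : ∀ {W : C} {x x' : W ⟶ A.carrier} {y : W ⟶ B.carrier}, R.Holds x x' → Maps f x' y →
      Maps f x y := by
    intro W x x' y h hy
    obtain ⟨W', e, _, y', h₁, h₂⟩ := holds_comp.1 h
    exact Maps.of_cover e (Maps.target h₁ (Maps.unique (holds_op.1 h₂) (hy.precomp e)))
  have hR' : ∀ {W : C} {x x' : W ⟶ A.carrier} {y : W ⟶ B.carrier}, Maps f x y → Maps f x' y →
      R.Holds x x' := fun h h' => Holds.comp h (holds_op.2 h')
  have hrefl : ∀ {W : C} (x : W ⟶ A.carrier), R.Holds x x := by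
    intro W x
    obtain ⟨W', e, _, y, hy⟩ := exists_maps f x
    exact holds_of_cover e (hR' hy hy)
  have hsymm : ∀ {W : C} {x x' : W ⟶ A.carrier}, R.Holds x x' → R.Holds x' x := by
    intro W x x' h
    obtain ⟨W', e, _, y, hy⟩ := exists_maps f x'
    exact holds_of_cover e (hR' hy (hR (h.precomp e) hy))
  have hE : R.IsEquiv := isEquiv_of_holds (fun W x => hrefl x) (fun W x x' => hsymm) (by
    intro W x x' x'' h h'
    obtain ⟨W', e, _, y, hy⟩ := exists_maps f x''
    exact holds_of_cover e (hR' (hR (h.precomp e) (hR (h'.precomp e) hy)) hy))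
  obtain ⟨e, he, he'⟩ := A.exists_quotient R hE (Hom.total f)
  let m : (⟨A.carrier, R, hE⟩ : ExReg C) ⟶ B := homOfHolds (A := ⟨A.carrier, R, hE⟩)
    (Hom.rel (A := A) f)
    (fun W x x' y h hy => hR h hy) (fun W x y y' h hy => Maps.target (f := f) h hy)
    (fun W x => exists_maps f x) (fun W x y y' h h' => Maps.unique (f := f) h h')
  refine ⟨R, hE, e, m, he, fun W x x' y h h' => hR' h h', ?_, fun _ _ _ => Iff.rfl⟩
  symm
  exact hom_ext_of_maps fun W x y hy => Maps.comp ((he' x x).2 (hrefl x)) (show Maps m x y from hy)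

lemma surjective_of_isIso (f : A ⟶ B) [IsIso f] : Surjective f := by
  intro W y
  obtain ⟨W', e, he, x, hx⟩ := exists_elt (B.elt y ≫ inv f)
  refine ⟨W', e, he, x, elt_comp_eq_iff.1 ?_⟩
  rw [← hx, Category.assoc, Category.assoc, IsIso.inv_hom_id, Category.comp_id, map_comp_elt]

lemma surjective_of_extremalEpi (f : A ⟶ B) [ExtremalEpi f] : Surjective f := by
  obtain ⟨R, hR, e, m, -, hm, hem, hmf⟩ := exists_image_factorisation f
  have := hm.mono
  have := ExtremalEpi.isIso f e m hem
  intro W y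
  obtain ⟨W', e, he, x, hx⟩ := surjective_of_isIso m y
  exact ⟨W', e, he, x, (hmf x _).1 hx⟩

lemma isIso_of_injective_of_surjective {f : A ⟶ B} (hf : Injective f) (hf' : Surjective f) :
    IsIso f := by
  have := hf.mono
  have := hf'.isRegularEpi
  exact isIso_of_mono_of_strongEpi f

lemma exists_maps_of_isPullback {P A B Z : ExReg C} {p : P ⟶ A} {q : P ⟶ B} {f : A ⟶ Z}
    {g : B ⟶ Z} (sq : IsPullback p q f g) {x : W ⟶ A.carrier} {y : W ⟶ B.carrier}
    {z : W ⟶ Z.carrier} (hx : Maps f x z) (hy : Maps g y z) :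
    ∃ (W' : C) (e : W' ⟶ W) (_ : StrongEpi e) (t : W' ⟶ P.carrier),
      Maps p t (e ≫ x) ∧ Maps q t (e ≫ y) := by
  have hw : A.elt x ≫ f = B.elt y ≫ g := by
    rw [elt_comp_eq_iff.2 hx, elt_comp_eq_iff.2 hy]
  obtain ⟨W', e, he, t, ht⟩ := exists_elt (sq.lift _ _ hw)
  refine ⟨W', e, he, t, elt_comp_eq_iff.1 ?_, elt_comp_eq_iff.1 ?_⟩
  · rw [← ht, Category.assoc, sq.lift_fst, map_comp_elt]
  · rw [← ht, Category.assoc, sq.lift_snd, map_comp_elt]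

end Surjections

section Exactness

instance : Regular (ExReg C) where
  hasCoequalizer_of_isKernelPair {A B K f g₁ g₂} hk := by
    obtain ⟨R, hR, e, m, he, hm, rfl, -⟩ := exists_image_factorisation f
    have := hm.mono
    have := he.isRegularEpi
    -- As `m` is monic, `f` and its surjective part `e` have the same kernel pair, whose coequalizer
    -- is `e`.
    exact ⟨⟨_, hk.cancel_right_of_mono.toCoequalizer'⟩⟩
  regularEpiIsStableUnderBaseChange := by
    constructor
    intro Y X S X' f p f' p' sq (hp : IsRegularEpi p)
    have hp' := surjective_of_extremalEpi p
    refine Surjective.isRegularEpi fun W y => ?_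
    obtain ⟨W₁, e₁, _, z, hz⟩ := exists_maps f y
    obtain ⟨W₂, e₂, _, x, hx⟩ := hp' z
    obtain ⟨W₃, e₃, _, t, -, ht⟩ := exists_maps_of_isPullback sq hx (hz.precomp e₂)
    exact ⟨W₃, e₃ ≫ e₂ ≫ e₁, inferInstance, t, by simpa using ht⟩

/-- An equivalence relation on `A` induces a coarser equivalence relation on the carrier of `A`;
keeping the carrier and using this relation gives the quotient. -/
lemma isBarrExact : IsBarrExact (ExReg C) where
  regular := inferInstance
  effective K A d c hdc := by
    obtain ⟨⟨E⟩⟩ := hdc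
    let R : Relation A.carrier A.carrier := Relation.comp (Relation.op (Hom.rel d)) (Hom.rel c)
    have hR : ∀ {W : C} {x y : W ⟶ A.carrier}, R.Holds x y →
        ∃ (W' : C) (e : W' ⟶ W) (_ : StrongEpi e) (t : W' ⟶ K.carrier),
          Maps d t (e ≫ x) ∧ Maps c t (e ≫ y) := by
      intro W x y h
      obtain ⟨W', e, he, t, h₁, h₂⟩ := holds_comp.1 h
      exact ⟨W', e, he, t, holds_op.1 h₁, h₂⟩
    have hR' : ∀ {W : C} {x y : W ⟶ A.carrier} {t : W ⟶ K.carrier}, Maps d t x → Maps c t y →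
        R.Holds x y := fun h h' => Holds.comp (holds_op.2 h) h'
    have hle : A.rel ≤ R := by
      refine le_iff.2 fun W x y hxy => ?_
      obtain ⟨W', e, _, t, ht⟩ := exists_elt (A.elt x ≫ E.r)
      refine holds_of_cover e (hR' (t := t) (elt_comp_eq_iff.1 ?_)
        (Maps.target (elt_comp_eq_iff.1 ?_) (hxy.precomp e)))
      · rw [← ht, Category.assoc, Category.assoc, E.reflexivity₁, Category.comp_id, map_comp_elt]
      · rw [← ht, Category.assoc, Category.assoc, E.reflexivity₂, Category.comp_id, map_comp_elt]
    have hequiv : R.IsEquiv := by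
      refine isEquiv_of_holds (fun W x => le_iff.1 hle _ _ (A.rel_refl x)) ?_ ?_
      · intro W x y h
        obtain ⟨W₁, e₁, _, t, h₁, h₂⟩ := hR h
        obtain ⟨W₂, e₂, _, t', ht'⟩ := exists_elt (K.elt t ≫ E.s)
        refine holds_of_cover e₁ (holds_of_cover e₂ (hR' (t := t') (elt_comp_eq_iff.1 ?_)
          (elt_comp_eq_iff.1 ?_)))
        · rw [← ht', Category.assoc, Category.assoc, E.symmetry₁, elt_comp_eq_iff.2 h₂,
            map_comp_elt]
        · rw [← ht', Category.assoc, Category.assoc, E.symmetry₂, elt_comp_eq_iff.2 h₁,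
            map_comp_elt]
      · intro W x y z hxy hyz
        obtain ⟨W₁, e₁, _, t, h₁, h₂⟩ := hR hxy
        obtain ⟨W₂, e₂, _, t', h₁', h₂'⟩ := hR (hyz.precomp e₁)
        have hw : K.elt (e₂ ≫ t) ≫ c = K.elt t' ≫ d := by
          rw [elt_comp_eq_iff.2 (h₂.precomp e₂), elt_comp_eq_iff.2 h₁']
        obtain ⟨l, hl₁, hl₂⟩ := PullbackCone.IsLimit.lift' E.isLimit _ _ hw
        obtain ⟨W₃, e₃, _, s, hs⟩ := exists_elt (l ≫ E.t)
        refine holds_of_cover e₁ (holds_of_cover e₂ (holds_of_cover e₃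
          (hR' (t := s) (elt_comp_eq_iff.1 ?_) (elt_comp_eq_iff.1 ?_))))
        · rw [← hs, Category.assoc, Category.assoc, E.transitivity₁, reassoc_of% hl₁,
            elt_comp_eq_iff.2 (h₁.precomp e₂), map_comp_elt]
        · rw [← hs, Category.assoc, Category.assoc, E.transitivity₂, reassoc_of% hl₂,
            elt_comp_eq_iff.2 h₂', map_comp_elt]
    obtain ⟨q, -, hq⟩ := A.exists_quotient R hequiv hle
    refine ⟨_, q, isPullback_of_maps ?_ ?_ ?_⟩
    · apply hom_ext_of_maps
      intro W t y ht
      obtain ⟨W₁, e₁, _, x, h₁, h₂⟩ := maps_comp.1 ht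
      obtain ⟨W₂, e₂, _, x', hx'⟩ := exists_maps c (e₁ ≫ t)
      refine Maps.of_cover e₁ (Maps.of_cover e₂ (Maps.comp hx' ((hq _ _).2 ?_)))
      exact rel_trans (A := ⟨A.carrier, R, hequiv⟩)
        (rel_symm (A := ⟨A.carrier, R, hequiv⟩) (hR' (h₁.precomp e₂) hx'))
        ((hq _ _).1 (h₂.precomp e₂))
    · intro W t t' x y h₁ h₂ h₃ h₄
      rw [← elt_eq_iff]
      apply E.right_cancellation
      · rw [elt_comp_eq_iff.2 h₁, elt_comp_eq_iff.2 h₂]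
      · rw [elt_comp_eq_iff.2 h₃, elt_comp_eq_iff.2 h₄]
    · intro W x y z hx hy
      exact hR (rel_trans (A := ⟨A.carrier, R, hequiv⟩) ((hq _ _).1 hx)
        (rel_symm (A := ⟨A.carrier, R, hequiv⟩) ((hq _ _).1 hy)))

end Exactness

section Embedding

instance : (embedding C).Faithful where
  map_injective {X Y} f g h := by
    have h' : Maps ((embedding C).map g) (𝟙 X) f :=
      h ▸ maps_embedding_map.2 (Category.id_comp f)
    simpa using (maps_embedding_map.1 h').symm

lemma surjective_map {X Y : C} (e : X ⟶ Y) [StrongEpi e] : Surjective ((embedding C).map e) :=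
  fun W (y : W ⟶ Y) => ⟨_, pullback.snd e y, inferInstance, pullback.fst e y,
    maps_embedding_map.2 pullback.condition⟩

instance : (embedding C).Full where
  map_surjective {X Y} F := by
    -- `F` is represented by `y` on a cover `e`; by faithfulness `y` coequalizes the kernel pair of
    -- `e`, so it descends.
    obtain ⟨W, e, _, (y : W ⟶ Y), hy⟩ := exists_elt F
    replace hy := hy.trans (embedding_elt (X := Y) y)
    obtain ⟨g, rfl⟩ := IsRegularEpi.exists_of_isKernelPair e (IsKernelPair.of_hasPullback e) y
      ((embedding C).map_injective (by
        rw [Functor.map_comp, Functor.map_comp, ← hy, ← Functor.map_comp_assoc,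
          pullback.condition, Functor.map_comp_assoc]))
    have := (surjective_map e).epi
    exact ⟨g, by rw [← cancel_epi ((embedding C).map e), hy, Functor.map_comp]⟩

lemma isPullback_embedding_map {P X Y Z : C} {p : P ⟶ X} {q : P ⟶ Y} {f : X ⟶ Z} {g : Y ⟶ Z}
    (sq : IsPullback p q f g) :
    IsPullback ((embedding C).map p) ((embedding C).map q) ((embedding C).map f)
      ((embedding C).map g) := by
  refine isPullback_of_maps (by rw [← Functor.map_comp, sq.w, Functor.map_comp]) ?_ ?_
  · intro W t t' x y h₁ h₂ h₃ h₄
    exact rel_embedding_obj.2 (sq.hom_ext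
      ((maps_embedding_map.1 h₁).trans (maps_embedding_map.1 h₂).symm)
      ((maps_embedding_map.1 h₃).trans (maps_embedding_map.1 h₄).symm))
  · intro W (x : W ⟶ X) (y : W ⟶ Y) z hx hy
    have hw := (maps_embedding_map.1 hx).trans (maps_embedding_map.1 hy).symm
    exact ⟨W, 𝟙 W, inferInstance, sq.lift x y hw,
      maps_embedding_map.2 ((sq.lift_fst x y hw).trans (Category.id_comp x).symm),
      maps_embedding_map.2 ((sq.lift_snd x y hw).trans (Category.id_comp y).symm)⟩

instance : PreservesFiniteLimits (embedding C) := by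
  have : PreservesLimitsOfShape WalkingCospan (embedding C) := by
    refine ⟨fun {K} => ?_⟩
    have : PreservesLimit (cospan (K.map WalkingCospan.Hom.inl) (K.map WalkingCospan.Hom.inr))
        (embedding C) := by
      have sq := IsPullback.of_hasPullback (K.map WalkingCospan.Hom.inl)
        (K.map WalkingCospan.Hom.inr)
      exact preservesLimit_of_preserves_limit_cone sq.isLimit
        ((isLimitMapConePullbackConeEquiv (embedding C) sq.w).symm
          (isPullback_embedding_map sq).isLimit)
    exact preservesLimit_of_iso_diagram _ (diagramIsoCospan K).symm
  have : PreservesLimit (Functor.empty.{0} C) (embedding C) :=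
    preservesTerminal_of_iso _ (isTerminalEmbeddingTerminal.uniqueUpToIso terminalIsTerminal)
  have := preservesLimitsOfShape_pempty_of_preservesTerminal (embedding C)
  exact preservesFiniteLimits_of_preservesTerminal_and_pullbacks _

/-- Injectivity of `m` identifies `M` with its set of values, namely the image in `X` of the second
projection of the relation `m`. -/
lemma essImage_of_mono {X : C} {M : ExReg C} (m : M ⟶ (embedding C).obj X) [Mono m] :
    (embedding C).essImage M := by
  have hm := injective_of_mono m
  let K : Relation M.carrier X := Hom.rel m
  let F := Regular.strongEpiMonoFactorisation (K.arrow ≫ prod.snd)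
  have : Mono F.m := F.m_mono
  have : StrongEpi F.e := inferInstance
  let J : Relation M.carrier F.I := pull (𝟙 _) F.m K
  have hJ : ∀ {W : C} {t : W ⟶ M.carrier} {b : W ⟶ F.I}, J.Holds t b ↔ Maps m t (b ≫ F.m) := by
    intro W t b
    change (pull (𝟙 _) F.m K).Holds t b ↔ _
    rw [holds_pull, Category.comp_id]
    rfl
  let φ : M ⟶ (embedding C).obj F.I := homOfHolds J
    (fun W t t' b htt' hb => hJ.2 ((hJ.1 hb).source htt'))
    (fun W t b b' hb hbb' => rel_embedding_obj.1 hbb' ▸ hb)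
    (fun W t => by
      obtain ⟨W', e, he, x, hx⟩ := exists_maps m t
      obtain ⟨k, -, hk⟩ := holds_iff.1 (show K.Holds (e ≫ t) x from hx)
      have hk' : (k ≫ F.e) ≫ F.m = x := by rw [Category.assoc, F.fac, hk]
      exact ⟨W', e, he, k ≫ F.e, hJ.2 (hk'.symm ▸ hx)⟩)
    (fun W t (b b' : W ⟶ F.I) hb hb' => rel_embedding_obj.2 ((cancel_mono F.m).1
      (rel_embedding_obj.1 ((hJ.1 hb).unique (hJ.1 hb')))))
  have hφ : IsIso φ := by
    apply isIso_of_injective_of_surjective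
    · exact fun W t t' b h h' => hm _ _ _ (hJ.1 h) (hJ.1 h')
    · intro W (b : W ⟶ F.I)
      have hF : pullback.fst F.e b ≫ K.arrow ≫ prod.snd = (pullback.snd F.e b ≫ b) ≫ F.m := by
        rw [Category.assoc, ← pullback.condition_assoc, F.fac]
      exact ⟨_, pullback.snd F.e b, inferInstance, pullback.fst F.e b ≫ K.arrow ≫ prod.fst,
        hJ.2 (holds_iff.2 ⟨pullback.fst F.e b, rfl, hF⟩)⟩
  exact ⟨F.I, ⟨(asIso φ).symm⟩⟩

lemma isCoveringEmbedding : IsCoveringEmbedding (embedding C) where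
  full := inferInstance
  faithful := inferInstance
  preservesFiniteLimits := inferInstance
  essImage_of_mono _ _ m _ := essImage_of_mono m
  -- The cover is the quotient map from the carrier with its identity relation.
  exists_cover Q := ⟨Q.carrier, Q.elt (𝟙 _), Surjective.isRegularEpi fun W y =>
    ⟨W, 𝟙 W, inferInstance, y, maps_elt.2 (rel_of_eq (by rw [Category.comp_id, Category.id_comp]))⟩⟩

end Embedding

end ExReg

end ExactCompletion

/-! ### Transport along equivalences, to adjust universes. -/

section Equivalences

attribute [local instance] uliftCategory in
/-- Any category is equivalent to one in larger universes. -/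
lemma exists_isEquivalence_lift (D : Type u) [Category.{v} D] :
    ∃ (E : Type max u w₁) (_ : Category.{max v w₂} E) (F : D ⥤ E), F.IsEquivalence :=
  ⟨ULiftHom.{w₂} (ULift.{w₁} D), inferInstance,
    (ULift.equivalence.trans ULiftHom.equiv).functor, inferInstance⟩

lemma isSemiLocalization_of_isEquivalence {X : Type*} [Category X] {C : Type*} [Category C]
    (U : X ⥤ C) [U.IsEquivalence] : IsSemiLocalization U := by
  let : Reflective U := { L := U.inv, adj := U.asEquivalence.symm.toAdjunction }
  refine ⟨inferInstance, isSemiLeftExact_of_isIso ?_⟩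
  intro Q P A f a b sq
  have : IsIso ((reflectorAdjunction U).unit.app Q) :=
    inferInstanceAs (IsIso (U.asEquivalence.symm.unit.app Q))
  have := sq.isIso_snd_of_isIso
  infer_instance

/-- An equivalence is a semi-localization, which gives regularity; effectivity is transported by
preserving equivalence relations and reflecting pullbacks. -/
lemma IsBarrExact.of_isEquivalence {X : Type u} [Category.{v} X] {C : Type w₁} [Category.{w₂} C]
    (U : X ⥤ C) [U.IsEquivalence] (hC : IsBarrExact C) : IsBarrExact X := by
  have := hC.regular
  have hU := isSemiLocalization_of_isEquivalence U
  have := hU.hasFiniteLimits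
  refine ⟨regular_of_hasStableCoequalizers (hU.hasStableCoequalizers hC.hasStableCoequalizers),
    fun R A d c hdc => ?_⟩
  have hmono : ∀ ⦃W : X⦄ (a b : W ⟶ R), a ≫ d = b ≫ d → a ≫ c = b ≫ c → a = b := by
    obtain ⟨⟨e⟩⟩ := hdc
    exact fun W a b => e.right_cancellation a b
  obtain ⟨Q, q, hq⟩ := hC.effective (U.map d) (U.map c)
    (isEquivalenceRelation_map U hdc (map_jointly_mono U.asEquivalence.symm.toAdjunction hmono))
  obtain ⟨q', hq'⟩ := U.map_surjective (q ≫ (U.objObjPreimageIso Q).inv)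
  refine ⟨U.objPreimage Q, q', IsPullback.of_map U ?_ ?_⟩
  · apply U.map_injective
    rw [U.map_comp, U.map_comp, hq', reassoc_of% hq.w]
  · rw [hq']
    exact hq.comp_of_mono

lemma IsCoveringEmbedding.comp_equivalence {X : Type*} [Category X] {D : Type*} [Category D]
    {D' : Type*} [Category D'] {I : X ⥤ D} (hI : IsCoveringEmbedding I) (F : D ⥤ D')
    [F.IsEquivalence] : IsCoveringEmbedding (I ⋙ F) := by
  have := hI.full
  have := hI.faithful
  have := hI.preservesFiniteLimits
  refine ⟨inferInstance, inferInstance, comp_preservesFiniteLimits _ _, ?_, ?_⟩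
  · intro A M m _
    let i := F.objObjPreimageIso M
    obtain ⟨m', hm'⟩ := F.map_surjective (i.hom ≫ m)
    have : Mono (F.map m') := by
      rw [hm']
      infer_instance
    obtain ⟨B, ⟨e⟩⟩ := hI.essImage_of_mono m' (F.mono_of_mono_map this)
    exact ⟨B, ⟨F.mapIso e ≪≫ i⟩⟩
  · intro Q
    let i := F.objObjPreimageIso Q
    obtain ⟨A, q, hq⟩ := hI.exists_cover (F.objPreimage Q)
    have hq' : IsRegularEpi (F.map q) := isRegularEpi_of_isColimit
      ⟨isColimitCoforkMapOfIsColimit F (IsRegularEpi.w q) (IsRegularEpi.isColimit q)⟩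
    exact ⟨A, F.map q ≫ i.hom,
      MorphismProperty.RespectsIso.postcomp (.regularEpi D') i.hom (F.map q) hq'⟩

end Equivalences

end SemiLoc

theorem mainTheorem4 (X : Type u) [Category.{v} X] :
    List.TFAE [
      Regular X ∧ SemiLoc.IsProtomodular X ∧
        SemiLoc.HasStableCoequalizersOfEquivalenceRelations X,
      ∃ (C : Type max u v w₁) (_ : Category.{max u v w₂} C),
        SemiLoc.IsBarrExact C ∧ SemiLoc.IsProtomodular C ∧
          ∃ U : X ⥤ C, SemiLoc.IsSemiLocalization U,
      ∃ (C : Type max u v w₁) (_ : Category.{max u v w₂} C),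
        SemiLoc.IsBarrExact C ∧ SemiLoc.IsProtomodular C ∧
          ∃ U : X ⥤ C, SemiLoc.IsSemiLocalizationWithRegularEpiUnits U,
      ∃ _ : Regular X,
        SemiLoc.IsSemiLocalization (SemiLoc.ExReg.embedding X) ∧
          SemiLoc.IsProtomodular (SemiLoc.ExReg X)] := by
  tfae_have 1 → 3 := by
    rintro ⟨_, hproto, hstable⟩
    -- The completion lives in fixed universes, so an equivalent copy is used to reach those of the
    -- statement.
    obtain ⟨E, _, F, _⟩ : ∃ (E : Type max u v w₁) (_ : Category.{max u v w₂} E)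
        (F : SemiLoc.ExReg X ⥤ E), F.IsEquivalence :=
      SemiLoc.exists_isEquivalence_lift.{w₁, w₂} (SemiLoc.ExReg X)
    have hE : SemiLoc.IsBarrExact E :=
      SemiLoc.IsBarrExact.of_isEquivalence F.inv SemiLoc.ExReg.isBarrExact
    have := hE.regular
    have hI := SemiLoc.ExReg.isCoveringEmbedding.comp_equivalence F
    exact ⟨E, inferInstance, hE, hI.isProtomodular hproto, _,
      hI.isSemiLocalizationWithRegularEpiUnits hstable⟩
  tfae_have 3 → 2 := by
    rintro ⟨C, _, hC, hC', U, hU, hU', -⟩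
    exact ⟨C, _, hC, hC', U, hU, hU'⟩
  tfae_have 2 → 1 := by
    rintro ⟨C, _, hC, hC', U, hU⟩
    exact hU.regular_protomodular_stable hC hC'
  tfae_have 1 → 4 := by
    rintro ⟨_, hproto, hstable⟩
    have hI := SemiLoc.ExReg.isCoveringEmbedding (C := X)
    obtain ⟨hU, hU', -⟩ := hI.isSemiLocalizationWithRegularEpiUnits hstable
    exact ⟨inferInstance, ⟨hU, hU'⟩, hI.isProtomodular hproto⟩
  tfae_have 4 → 1 := by
    rintro ⟨_, hU, hproto⟩
    exact hU.regular_protomodular_stable SemiLoc.ExReg.isBarrExact hproto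
  tfae_finish
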